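/- Let $d, m\ge 0$ be integers and let $X\subseteq\mathbb{R}^d$ be compact. **Spaces.** $\mathscr{E}^m(\mathbb{R}^d)$ is the space of complex-valued $C^m$ functions on $\mathbb{R}^d$ with the topology of the seminorms $\|f\|_k^K=\sup_{x\in K,\,|\nu|\le k}|\partial^\nu f(x)|$ ($K\subset\mathbb{R}^d$ compact, $0\le k\le m$). $\mathcal{I}^m(X,\mathbb{R}^d)$ is the subspace of those $f$ with $\partial^\nu f=0$ on $X$ for all $|\nu|\le m$, with the induced topology, and $i$ is its inclusion in $\mathscr{E}^m(\mathbb{R}^d)$. For a family $F=(f^k)_{|k|\le m}$ of continuous functions $f^k:X\to\mathbb{C}$ (a jet of order $m$) and $a\in X$ put $$T^m_aF(x)=\sum_{|k|\le m}\frac{(x-a)^k}{k!}f^k(a),\qquad (R^m_aF)^k=f^k-\partial^k(T^m_aF)|_X\quad(|k|\le m).$$ $\mathscr{E}^m(X)$ is the space of jets $F$ with $(R^m_xF)^k(y)=o(|x-y|^{m-|k|})$ as $|x-y|\to0$, uniformly in $x,y\in X$, for all $|k|\le m$; its norm is $$\|F\|_m^X=\sup_{x\in X,\,|k|\le m}|f^k(x)|+\sup_{x\ne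 y\in X,\,|k|\le m}\frac{|(R^m_xF)^k(y)|}{|x-y|^{m-|k|}}.$$ The jet map $J^m:\mathscr{E}^m(\mathbb{R}^d)\to\mathscr{E}^m(X)$, $J^m(g)=(\partial^kg|_X)_{|k|\le m}$, is linear and continuous. A prime denotes the continuous dual with the weak star topology, and the transpose of a continuous linear map. **Theorem.** The sequences $$0\to\mathcal{I}^m(X,\mathbb{R}^d)\xrightarrow{\,i\,}\mathscr{E}^m(\mathbb{R}^d)\xrightarrow{J^m}\mathscr{E}^m(X)\to0,\qquad 0\to\mathscr{E}^m(X)'\xrightarrow{{J^m}'}\mathscr{E}^m(\mathbb{R}^d)'\xrightarrow{\,i'\,}\mathcal{I}^m(X,\mathbb{R}^d)'\to0$$ are exact, and the following three sets are nonempty and in natural bijection: 1. the set $\mathfrak{D}$ of closed subspaces $D$ of $\mathscr{E}^m(\mathbb{R}^d)$ with $\mathscr{E}^m(\mathbb{R}^d)=\mathcal{I}^m(X,\mathbb{R}^d)\oplus D$; 2. the set $\mathscr{S}$ of continuous linear $T:\mathscr{E}^m(X)\to\mathscr{E}^m(\mathbb{R}^d)$ with $J^m\circ T=\mathrm{Id}$;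 3. the set $\mathscr{R}$ of weak-star continuous linear $\mathcal{R}:\mathcal{I}^m(X,\mathbb{R}^d)'\to\mathscr{E}^m(\mathbb{R}^d)'$ with $i'\circ\mathcal{R}=\mathrm{Id}$. The bijections are as follows. $\mathcal{F}:\mathscr{R}\to\mathfrak{D}$ is given by $\mathcal{F}(\mathcal{R})=\{\varphi:\mu(\varphi)=0\ \text{for all }\mu\text{ in the range of }\mathcal{R}\}$, and $\mathcal{F}^{-1}(D)$ is the transpose of the projection $\mathcal{I}^m(X,\mathbb{R}^d)\oplus D\to\mathcal{I}^m(X,\mathbb{R}^d)$. $\mathcal{J}:\mathscr{R}\to\mathscr{S}$ is given by $\mathcal{J}(\mathcal{R})=(J^m|_{\mathcal{F}(\mathcal{R})})^{-1}$ (so $\mathcal{J}(\mathcal{R})$ has range $\mathcal{F}(\mathcal{R})$), and $\mathcal{J}^{-1}(T)$ is the transpose of $\varphi\mapsto\varphi-T(J^m\varphi)$, $\mathscr{E}^m(\mathbb{R}^d)\to\mathcal{I}^m(X,\mathbb{R}^d)$. -/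

import Mathlib

noncomputable section

open TopologicalSpace Uniformity Asymptotics

namespace Whitney

/-- `ℝ^d` with the Euclidean norm. -/
abbrev Euc (d : ℕ) : Type := EuclideanSpace ℝ (Fin d)

/-- The multi-indices `ν = (ν_1, …, ν_d)` with `|ν| = ν_1 + ⋯ + ν_d ≤ m`. -/
abbrev MultiIndex (d m : ℕ) : Type := {ν : Fin d → ℕ // ∑ i, ν i ≤ m}

instance (d m : ℕ) : Finite (MultiIndex d m) :=
  Set.Finite.to_subtype <| (Set.finite_Iic (fun _ : Fin d => m)).subset fun ν hν i =>
    (Finset.single_le_sum (fun j _ => Nat.zero_le (ν j)) (Finset.mem_univ i)).trans hν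

instance (d m : ℕ) : Fintype (MultiIndex d m) := Fintype.ofFinite _

/-- The first order partial derivative `∂_i f`. -/
def pd {d : ℕ} (i : Fin d) (f : Euc d → ℂ) : Euc d → ℂ :=
  fun x => fderiv ℝ f x (EuclideanSpace.single i 1)

/-- The list `1, …, 1, 2, …, 2, …, d, …, d` in which the index `i` occurs `ν_i` times. -/
def indexList {d : ℕ} (ν : Fin d → ℕ) : List (Fin d) :=
  (List.finRange d).flatMap fun i => List.replicate (ν i) i

/-- The partial derivative `∂^ν f = ∂_1^{ν_1} ⋯ ∂_d^{ν_d} f`, the composite of the `∂_i` along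
`indexList ν`. -/
def partialDeriv {d : ℕ} (ν : Fin d → ℕ) (f : Euc d → ℂ) : Euc d → ℂ :=
  (indexList ν).foldr pd f

section aux
variable {d : ℕ}

theorem count_indexList (ν : Fin d → ℕ) (i : Fin d) : (indexList ν).count i = ν i := by
  simp only [indexList, List.count_flatMap, Function.comp_def, List.count_replicate]
  have : ∀ l : List (Fin d), l.Nodup → (l.map fun j => if (j == i) = true then ν j else 0).sum
      = if i ∈ l then ν i else 0 := by
    intro l hl
    induction l with
    | nil => simp
    | cons a l ih =>
      rw [List.nodup_cons] at hl
      rw [List.map_cons, List.sum_cons, ih hl.2]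
      by_cases h : a = i
      · subst h; simp [hl.1]
      · simp [h, Ne.symm h]
  rw [this _ (List.nodup_finRange d)]; simp

theorem length_indexList (ν : Fin d → ℕ) : (indexList ν).length = ∑ i, ν i := by
  simp [indexList, List.length_flatMap, Fin.sum_univ_def]

theorem sum_count (L : List (Fin d)) : ∑ i, L.count i = L.length := by
  simpa using (Multiset.sum_count_eq_card (s := Finset.univ) (m := (L : Multiset (Fin d)))
    (fun _ _ => Finset.mem_univ _))

theorem contDiff_pd {n : ℕ} {f : Euc d → ℂ} (hf : ContDiff ℝ (n + 1 : ℕ) f) (i : Fin d) :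
    ContDiff ℝ n (pd i f) :=
  (hf.fderiv_right (m := n) (by norm_cast)).clm_apply contDiff_const

theorem contDiff_foldr_pd {n : ℕ} {f : Euc d → ℂ} (L : List (Fin d))
    (hf : ContDiff ℝ (n + L.length : ℕ) f) : ContDiff ℝ n (L.foldr pd f) := by
  induction L generalizing n with
  | nil => simpa using hf
  | cons i L ih =>
    refine contDiff_pd (ih (n := n + 1) ?_) i
    convert hf using 2
    simp; ring

theorem contDiff_foldr_pd' {n m : ℕ} {f : Euc d → ℂ} (L : List (Fin d)) (h : n + L.length ≤ m)
    (hf : ContDiff ℝ m f) : ContDiff ℝ n (L.foldr pd f) :=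
  contDiff_foldr_pd L (hf.of_le (by exact_mod_cast h))

theorem pd_add {f g : Euc d → ℂ} (hf : ContDiff ℝ (1 : ℕ) f) (hg : ContDiff ℝ (1 : ℕ) g)
    (i : Fin d) : pd i (f + g) = pd i f + pd i g := by
  funext x
  simp only [pd, Pi.add_apply]
  rw [fderiv_add (hf.differentiable (by norm_num) x) (hg.differentiable (by norm_num) x)]
  rfl

theorem pd_smul (c : ℂ) {f : Euc d → ℂ} (hf : ContDiff ℝ (1 : ℕ) f) (i : Fin d) :
    pd i (c • f) = c • pd i f := by
  funext x
  simp only [pd, Pi.smul_apply]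
  rw [fderiv_const_smul (hf.differentiable (by norm_num) x) c]
  rfl

theorem foldr_pd_add {m : ℕ} {f g : Euc d → ℂ} (hf : ContDiff ℝ m f) (hg : ContDiff ℝ m g)
    (L : List (Fin d)) (h : L.length ≤ m) :
    L.foldr pd (f + g) = L.foldr pd f + L.foldr pd g := by
  induction L with
  | nil => rfl
  | cons i L ih =>
    simp only [List.length_cons] at h
    rw [List.foldr_cons, ih (by omega),
      pd_add (contDiff_foldr_pd' L (by omega) hf) (contDiff_foldr_pd' L (by omega) hg)]
    rfl

theorem foldr_pd_smul {m : ℕ} (c : ℂ) {f : Euc d → ℂ} (hf : ContDiff ℝ m f)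
    (L : List (Fin d)) (h : L.length ≤ m) :
    L.foldr pd (c • f) = c • L.foldr pd f := by
  induction L with
  | nil => rfl
  | cons i L ih =>
    simp only [List.length_cons] at h
    rw [List.foldr_cons, ih (by omega), pd_smul c (contDiff_foldr_pd' L (by omega) hf)]
    rfl

theorem pd_comm {f : Euc d → ℂ} (hf : ContDiff ℝ (2 : ℕ) f) (i j : Fin d) :
    pd i (pd j f) = pd j (pd i f) := by
  have key : ∀ (i j : Fin d) x, pd i (pd j f) x
      = fderiv ℝ (fderiv ℝ f) x (EuclideanSpace.single i 1) (EuclideanSpace.single j 1) := by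
    intro i j x
    have h : DifferentiableAt ℝ (fderiv ℝ f) x :=
      ((hf.fderiv_right (m := 1) (by norm_cast)).differentiable (by norm_num)) x
    show fderiv ℝ (fun y => fderiv ℝ f y (EuclideanSpace.single j 1)) x _ = _
    rw [fderiv_clm_apply h (differentiableAt_const _)]
    simp
  funext x
  rw [key, key]
  exact (hf.contDiffAt (x := x)).isSymmSndFDerivAt (by simp) _ _

theorem foldr_pd_perm {m : ℕ} {f : Euc d → ℂ} (hf : ContDiff ℝ m f) {L L' : List (Fin d)}
    (h : L.Perm L') (hL : L.length ≤ m) : L.foldr pd f = L'.foldr pd f := by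
  induction h with
  | nil => rfl
  | cons i h ih => simp only [List.length_cons] at hL; simp [ih (by omega)]
  | swap i j L =>
    simp only [List.length_cons] at hL
    exact pd_comm (contDiff_foldr_pd' L (by omega) hf) j i
  | trans h₁ h₂ ih₁ ih₂ => rw [ih₁ hL, ih₂ (h₁.length_eq ▸ hL)]

theorem foldr_pd_eq_partialDeriv {m : ℕ} {f : Euc d → ℂ} (hf : ContDiff ℝ m f)
    (L : List (Fin d)) (hL : L.length ≤ m) :
    L.foldr pd f = partialDeriv (fun i => L.count i) f :=
  foldr_pd_perm hf (List.perm_iff_count.2 fun i => (count_indexList (fun j => L.count j) i).symm) hL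

theorem foldr_pd_eq_iteratedFDeriv {m : ℕ} {f : Euc d → ℂ} (hf : ContDiff ℝ m f)
    (L : List (Fin d)) (hL : L.length ≤ m) (x : Euc d) :
    L.foldr pd f x
      = iteratedFDeriv ℝ L.length f x (fun j => EuclideanSpace.single (L.get j) 1) := by
  induction L generalizing x with
  | nil => simp
  | cons i L ih =>
    simp only [List.length_cons] at hL
    have h : L.foldr pd f = fun y =>
      iteratedFDeriv ℝ L.length f y (fun j => EuclideanSpace.single (L.get j) 1) :=
      funext fun y => ih (by omega) y
    have hd : DifferentiableAt ℝ (iteratedFDeriv ℝ L.length f) x :=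
      hf.differentiable_iteratedFDeriv (by exact_mod_cast hL) x
    rw [List.foldr_cons, h]
    show fderiv ℝ _ x _ = iteratedFDeriv ℝ (L.length + 1) f x _
    rw [iteratedFDeriv_succ_apply_left]
    have := (hd.hasFDerivAt.continuousMultilinear_apply_const
      (fun j => EuclideanSpace.single (L.get j) 1)).fderiv
    rw [this]
    rfl


theorem norm_le_sum_apply_single {n : ℕ} (A : ContinuousMultilinearMap ℝ (fun _ : Fin n => Euc d) ℂ) :
    ‖A‖ ≤ ∑ s : Fin n → Fin d, ‖A fun j => EuclideanSpace.single (s j) 1‖ := by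
  refine A.opNorm_le_bound (Finset.sum_nonneg fun _ _ => norm_nonneg _) fun v => ?_
  have hv : v = fun j => ∑ i, v j i • (EuclideanSpace.single i 1 : Euc d) := by
    funext j; ext k
    simp [Pi.single_apply]
  have hs : A v = ∑ s : Fin n → Fin d, (∏ j, v j (s j)) •
      A fun j => EuclideanSpace.single (s j) 1 := by
    conv_lhs => rw [hv]
    rw [A.map_sum]
    exact Finset.sum_congr rfl fun s _ => A.map_smul_univ _ _
  rw [hs, Finset.sum_mul]
  refine (norm_sum_le _ _).trans (Finset.sum_le_sum fun s _ => ?_)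
  rw [norm_smul, mul_comm, norm_prod]
  gcongr with j _
  exact PiLp.norm_apply_le (v j) (s j)

/-- The monomial `(z - a)^ν / ν!`. -/
def taylorMonomial (ν : Fin d → ℕ) (a z : Euc d) : ℝ :=
  ∏ i, (z i - a i) ^ ν i / (ν i).factorial

theorem contDiff_taylorMonomial (ν : Fin d → ℕ) (a : Euc d) {n : WithTop ℕ∞} :
    ContDiff ℝ n fun z => (taylorMonomial ν a z : ℂ) := by
  have h : ContDiff ℝ n (taylorMonomial ν a) := by
    unfold taylorMonomial
    refine contDiff_prod fun i _ => ?_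
    refine ContDiff.div_const (ContDiff.pow ?_ _) _
    exact ((EuclideanSpace.proj (𝕜 := ℝ) i).contDiff).sub contDiff_const
  exact Complex.ofRealCLM.contDiff.comp h

theorem continuous_taylorMonomial (ν : Fin d → ℕ) :
    Continuous fun p : Euc d × Euc d => taylorMonomial ν p.1 p.2 := by
  unfold taylorMonomial
  fun_prop

theorem pd_taylorMonomial (ν : Fin d → ℕ) (a : Euc d) (i : Fin d) :
    pd i (fun z => (taylorMonomial ν a z : ℂ)) =
      if 1 ≤ ν i then fun z => (taylorMonomial (fun j => if j = i then ν j - 1 else ν j) a z : ℂ)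
      else 0 := by
  funext z
  have hd : DifferentiableAt ℝ (fun z => (taylorMonomial ν a z : ℂ)) z :=
    (contDiff_taylorMonomial ν a (n := 1)).differentiable (by norm_num) z
  have h1 := hd.hasFDerivAt.hasLineDerivAt (EuclideanSpace.single i 1)
  have h2 : HasDerivAt (fun t : ℝ => (z i + t - a i) ^ ν i / ((ν i).factorial : ℝ) *
      ∏ j ∈ Finset.univ.erase i, (z j - a j) ^ ν j / ((ν j).factorial : ℝ))
      ((ν i : ℝ) * (z i - a i) ^ (ν i - 1) / ((ν i).factorial : ℝ) *
      ∏ j ∈ Finset.univ.erase i, (z j - a j) ^ ν j / ((ν j).factorial : ℝ)) 0 := by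
    have h0 : HasDerivAt (fun t : ℝ => z i + t - a i) 1 0 :=
      ((hasDerivAt_id (0 : ℝ)).const_add (z i)).sub_const (a i)
    have := ((h0.pow (ν i)).div_const ((ν i).factorial : ℝ)).mul_const
      (∏ j ∈ Finset.univ.erase i, (z j - a j) ^ ν j / ((ν j).factorial : ℝ))
    simpa using this
  have hfun : (fun t : ℝ => taylorMonomial ν a (z + t • EuclideanSpace.single i 1)) =
      fun t : ℝ => (z i + t - a i) ^ ν i / ((ν i).factorial : ℝ) *
      ∏ j ∈ Finset.univ.erase i, (z j - a j) ^ ν j / ((ν j).factorial : ℝ) := by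
    funext t
    unfold taylorMonomial
    rw [← Finset.mul_prod_erase _ _ (Finset.mem_univ i)]
    congr 1
    · simp
    · refine Finset.prod_congr rfl fun j hj => ?_
      simp [Finset.ne_of_mem_erase hj]
  rw [← hfun] at h2
  have h3 := (h1.unique (show HasLineDerivAt ℝ _ _ z (EuclideanSpace.single i 1) from h2.ofReal_comp))
  show fderiv ℝ _ z _ = _
  rw [h3]
  split_ifs with hν
  · congr 1
    unfold taylorMonomial
    rw [← Finset.mul_prod_erase Finset.univ _ (Finset.mem_univ i)]
    congr 1
    · simp only [if_true]
      obtain ⟨k, hk⟩ : ∃ k, ν i = k + 1 := ⟨ν i - 1, by omega⟩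
      rw [hk]
      simp only [Nat.add_sub_cancel, Nat.factorial_succ]
      push_cast
      have : (k.factorial : ℝ) ≠ 0 := by positivity
      field_simp
    · refine Finset.prod_congr rfl fun j hj => ?_
      simp [Finset.ne_of_mem_erase hj]
  · have : ν i = 0 := by omega
    simp [this]

theorem foldr_pd_taylorMonomial (ν : Fin d → ℕ) (a : Euc d) (L : List (Fin d)) :
    L.foldr pd (fun z => (taylorMonomial ν a z : ℂ)) =
      if ∀ i, L.count i ≤ ν i then fun z => (taylorMonomial (fun j => ν j - L.count j) a z : ℂ)
      else 0 := by
  induction L with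
  | nil => simp
  | cons i L ih =>
    rw [List.foldr_cons, ih]
    by_cases h : ∀ j, L.count j ≤ ν j
    · rw [if_pos h, pd_taylorMonomial]
      by_cases h' : 1 ≤ ν i - L.count i
      · rw [if_pos h', if_pos]
        · funext z
          congr 2
          funext j
          by_cases hj : j = i
          · subst hj; simp; omega
          · simp [hj, Ne.symm hj]
        · intro j
          by_cases hj : j = i
          · subst hj; have := h j; simp; omega
          · simpa [Ne.symm hj] using h j
      · rw [if_neg h', if_neg]
        intro h2
        have := h2 i
        simp at this
        omega
    · rw [if_neg h, if_neg]
      · funext x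
        simp [pd]
      · exact fun h2 => h fun j => (List.count_le_count_cons).trans (h2 j)

theorem taylorMonomial_self (ν : Fin d → ℕ) (a : Euc d) :
    taylorMonomial ν a a = if ν = 0 then 1 else 0 := by
  unfold taylorMonomial
  split_ifs with h
  · simp [h]
  · obtain ⟨i, hi⟩ := Function.ne_iff.1 h
    exact Finset.prod_eq_zero (Finset.mem_univ i) (by simp at hi; simp [hi])

theorem partialDeriv_add {m : ℕ} {f g : Euc d → ℂ} (hf : ContDiff ℝ m f) (hg : ContDiff ℝ m g)
    (ν : Fin d → ℕ) (h : ∑ i, ν i ≤ m) :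
    partialDeriv ν (f + g) = partialDeriv ν f + partialDeriv ν g :=
  foldr_pd_add hf hg _ (by rwa [length_indexList])

theorem partialDeriv_smul {m : ℕ} (c : ℂ) {f : Euc d → ℂ} (hf : ContDiff ℝ m f)
    (ν : Fin d → ℕ) (h : ∑ i, ν i ≤ m) : partialDeriv ν (c • f) = c • partialDeriv ν f :=
  foldr_pd_smul c hf _ (by rwa [length_indexList])

theorem continuous_partialDeriv {m : ℕ} {f : Euc d → ℂ} (hf : ContDiff ℝ m f)
    (ν : Fin d → ℕ) (h : ∑ i, ν i ≤ m) : Continuous (partialDeriv ν f) :=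
  (contDiff_foldr_pd' (n := 0) (m := m) (indexList ν) (by rw [length_indexList]; omega) hf).continuous

end aux

/-- The complex valued functions of class `C^m` on `ℝ^d`, as a subspace of all functions. -/
def cmSubmodule (d m : ℕ) : Submodule ℂ (Euc d → ℂ) where
  carrier := {f | ContDiff ℝ m f}
  add_mem' {f g} (hf : ContDiff ℝ m f) (hg : ContDiff ℝ m g) := hf.add hg
  zero_mem' := show ContDiff ℝ m (fun _ => (0 : ℂ)) from contDiff_const
  smul_mem' c f (hf : ContDiff ℝ m f) := hf.const_smul c

/-- `E^m(ℝ^d)`: the complex valued `C^m` functions on `ℝ^d`. This is a type of its own, so that it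
does not inherit the topology of pointwise convergence; its topology is defined below. -/
def Cm (d m : ℕ) : Type := cmSubmodule d m

namespace Cm
variable {d m : ℕ}

instance : AddCommGroup (Cm d m) := inferInstanceAs (AddCommGroup (cmSubmodule d m))
instance : Module ℂ (Cm d m) := inferInstanceAs (Module ℂ (cmSubmodule d m))
instance : CoeFun (Cm d m) fun _ => Euc d → ℂ := ⟨fun f => f.1⟩

theorem contDiff (f : Cm d m) : ContDiff ℝ m f := f.2

theorem bddAbove_seminorm (K : Compacts (Euc d)) (k : Fin (m + 1)) (f : Cm d m) :
    BddAbove (Set.range fun p : K × MultiIndex d k => ‖partialDeriv p.2.1 f p.1‖) := by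
  have h : ∀ ν : MultiIndex d k, ∃ C, ∀ x : K, ‖partialDeriv ν.1 f x‖ ≤ C := fun ν => by
    obtain ⟨C, hC⟩ := K.isCompact.exists_bound_of_continuousOn
      (continuous_partialDeriv f.contDiff ν.1 (ν.2.trans (Nat.lt_succ_iff.1 k.2))).continuousOn
    exact ⟨C, fun x => hC x x.2⟩
  choose C hC using h
  obtain ⟨M, hM⟩ := (Set.finite_range C).bddAbove
  exact ⟨M, by rintro _ ⟨⟨x, ν⟩, rfl⟩; exact (hC ν x).trans (hM ⟨ν, rfl⟩)⟩

/-- `‖f‖_k^K = sup_{x ∈ K, |ν| ≤ k} |∂^ν f(x)|`, for `K` compact and `0 ≤ k ≤ m`. -/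
def seminorm (d m : ℕ) : SeminormFamily ℂ (Cm d m) (Compacts (Euc d) × Fin (m + 1)) := fun q =>
  Seminorm.of (fun f => ⨆ p : q.1 × MultiIndex d q.2, ‖partialDeriv p.2.1 f p.1‖)
    (fun f g => Real.iSup_le (fun p => by
        have h : partialDeriv p.2.1 (f + g : Cm d m) =
            partialDeriv p.2.1 f + partialDeriv p.2.1 g :=
          partialDeriv_add f.contDiff g.contDiff _ (p.2.2.trans (Nat.lt_succ_iff.1 q.2.2))
        rw [h]
        exact (norm_add_le _ _).trans (add_le_add (le_ciSup (bddAbove_seminorm q.1 q.2 f) p)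
          (le_ciSup (bddAbove_seminorm q.1 q.2 g) p)))
      (add_nonneg (Real.iSup_nonneg fun _ => norm_nonneg _)
        (Real.iSup_nonneg fun _ => norm_nonneg _)))
    (fun c f => by
      rw [Real.mul_iSup_of_nonneg (norm_nonneg c)]
      congr 1
      funext p
      have h : partialDeriv p.2.1 (c • f : Cm d m) = c • partialDeriv p.2.1 f :=
        partialDeriv_smul c f.contDiff _ (p.2.2.trans (Nat.lt_succ_iff.1 q.2.2))
      rw [h]
      exact norm_smul c (partialDeriv p.2.1 f p.1))

/-- The locally convex topology defined by the seminorms `‖·‖_k^K`. -/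
instance : TopologicalSpace (Cm d m) := (seminorm d m).moduleFilterBasis.topology

theorem withSeminorms (d m : ℕ) : WithSeminorms (seminorm d m) := ⟨rfl⟩

instance : IsTopologicalAddGroup (Cm d m) := (withSeminorms d m).topologicalAddGroup
instance : ContinuousSMul ℂ (Cm d m) := (withSeminorms d m).continuousSMul

end Cm

/-- Jets of order `m` on the compact set `X`: families `F = (f^k)_{|k| ≤ m}` of continuous functions
`f^k : X → ℂ`. -/
abbrev Jet (m : ℕ) {d : ℕ} (X : Compacts (Euc d)) : Type := MultiIndex d m → C(X, ℂ)

section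
variable {d m : ℕ} {X : Compacts (Euc d)}

/-- The jet `J^m(g) = (∂^k g|_X)_{|k| ≤ m}` of a `C^m` function. -/
def jetOf (X : Compacts (Euc d)) : Cm d m →ₗ[ℂ] Jet m X where
  toFun g := fun k => ⟨fun x => partialDeriv k.1 g x,
    (continuous_partialDeriv g.contDiff k.1 k.2).comp continuous_subtype_val⟩
  map_add' f g := by
    funext k; ext x
    exact congrFun (partialDeriv_add f.contDiff g.contDiff k.1 k.2) x
  map_smul' c f := by
    funext k; ext x
    exact congrFun (partialDeriv_smul c f.contDiff k.1 k.2) x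

/-- The Taylor polynomial `T^m_a F(x) = ∑_{|k| ≤ m} (x - a)^k / k! f^k(a)`. -/
def taylorPoly (F : Jet m X) (a : X) : Cm d m :=
  ⟨fun x => ∑ k : MultiIndex d m, (taylorMonomial k.1 a x : ℂ) * F k a,
    show ContDiff ℝ m _ from
      ContDiff.sum fun _ _ => (contDiff_taylorMonomial _ _).mul contDiff_const⟩

/-- `R^m_a F = F - J^m(T^m_a F)`. -/
def remainder (F : Jet m X) (a : X) : Jet m X := F - jetOf X (taylorPoly F a)

theorem remainder_add (F G : Jet m X) (a : X) :
    remainder (F + G) a = remainder F a + remainder G a := by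
  have : taylorPoly (F + G) a = taylorPoly F a + taylorPoly G a :=
    Subtype.ext <| funext fun x => by
      show _ = (∑ k : MultiIndex d m, (taylorMonomial k.1 a x : ℂ) * F k a) +
        ∑ k : MultiIndex d m, (taylorMonomial k.1 a x : ℂ) * G k a
      simp [taylorPoly, mul_add, Finset.sum_add_distrib]
  rw [remainder, this, map_add, remainder, remainder]
  abel

theorem remainder_smul (c : ℂ) (F : Jet m X) (a : X) :
    remainder (c • F) a = c • remainder F a := by
  have : taylorPoly (c • F) a = c • taylorPoly F a :=
    Subtype.ext <| funext fun x => by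
      show _ = c * ∑ k : MultiIndex d m, (taylorMonomial k.1 a x : ℂ) * F k a
      simp [taylorPoly, Finset.mul_sum, mul_left_comm]
  rw [remainder, this, map_smul, remainder, smul_sub]

theorem remainder_zero (a : X) : remainder (0 : Jet m X) a = 0 := by
  simpa using remainder_smul 0 (0 : Jet m X) a

/-- The Whitney condition `(R^m_x F)^k(y) = o(|x - y|^{m - |k|})` as `|x - y| → 0`, uniformly in
`x, y ∈ X`, for all `|k| ≤ m`. -/
def IsWhitney (F : Jet m X) : Prop :=
  ∀ k : MultiIndex d m,
    (fun p : X × X => remainder F p.1 k p.2) =o[𝓤 X] fun p => dist p.1 p.2 ^ (m - ∑ i, k.1 i)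

/-- The jets that satisfy the Whitney condition, as a subspace of all jets. -/
def whitneySubmodule (m : ℕ) (X : Compacts (Euc d)) : Submodule ℂ (Jet m X) where
  carrier := {F | IsWhitney F}
  add_mem' {F G} hF hG k := by
    simp only [remainder_add]
    exact (hF k).add (hG k)
  zero_mem' k := by
    simp only [remainder_zero]
    exact isLittleO_zero _ _
  smul_mem' c F hF k := by
    simp only [remainder_smul]
    exact (hF k).const_smul_left c

/-- `E^m(X)`: the functions on `X` differentiable of order `m` in the sense of Whitney. This is a
type of its own, so that it does not inherit the supremum norm of jets; its norm is defined below. -/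
def WhitneyJet (m : ℕ) (X : Compacts (Euc d)) : Type := whitneySubmodule m X

theorem foldr_pd_taylorPoly (F : Jet m X) (a : X) (L : List (Fin d)) (hL : L.length ≤ m)
    (z : Euc d) : L.foldr pd (taylorPoly F a) z = ∑ k : MultiIndex d m,
      (if ∀ i, L.count i ≤ k.1 i then (taylorMonomial (fun j => k.1 j - L.count j) a z : ℂ)
        else 0) * F k a := by
  have h : ((taylorPoly F a : Cm d m) : Euc d → ℂ) =
      ∑ k : MultiIndex d m, F k a • fun z => (taylorMonomial k.1 a z : ℂ) := by
    funext x
    simp [taylorPoly, mul_comm]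
  have hsum : ∀ s : Finset (MultiIndex d m),
      L.foldr pd (∑ k ∈ s, F k a • fun z => (taylorMonomial k.1 a z : ℂ)) =
      ∑ k ∈ s, F k a • L.foldr pd (fun z => (taylorMonomial k.1 a z : ℂ)) := by
    intro s
    induction s using Finset.induction_on with
    | empty =>
      have := foldr_pd_smul (m := m) 0 (f := (0 : Euc d → ℂ)) contDiff_const L hL
      simpa using this
    | insert k s hk ih =>
      rw [Finset.sum_insert hk, Finset.sum_insert hk, foldr_pd_add (m := m) _ _ L hL, ih,
        foldr_pd_smul (m := m) _ _ L hL]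
      · exact contDiff_taylorMonomial _ _
      · exact (contDiff_taylorMonomial _ _).const_smul (F k a)
      · have : (∑ k ∈ s, F k a • fun z => (taylorMonomial k.1 a z : ℂ)) =
          fun z => ∑ k ∈ s, F k a • (taylorMonomial k.1 a z : ℂ) := by
            funext z; simp
        rw [this]
        exact ContDiff.sum fun k _ => (contDiff_taylorMonomial _ _).const_smul (F k a)
  rw [h, hsum, Finset.sum_apply]
  refine Finset.sum_congr rfl fun k _ => ?_
  rw [foldr_pd_taylorMonomial, Pi.smul_apply, smul_eq_mul, mul_comm]
  congr 1
  split_ifs <;> rfl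

theorem continuous_remainder (F : Jet m X) (k : MultiIndex d m) :
    Continuous fun p : X × X => remainder F p.1 k p.2 := by
  have : ∀ p : X × X, remainder F p.1 k p.2 = F k p.2 -
      (indexList k.1).foldr pd (taylorPoly F p.1) p.2 := fun p => rfl
  simp only [this]
  simp only [foldr_pd_taylorPoly F _ (indexList k.1) (by rw [length_indexList]; exact k.2)]
  refine ((F k).continuous.comp continuous_snd).sub (continuous_finsetSum _ fun l _ => ?_)
  refine Continuous.mul ?_ ((F l).continuous.comp continuous_fst)
  split_ifs
  · exact Complex.continuous_ofReal.comp ((continuous_taylorMonomial _).comp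
      ((continuous_subtype_val.comp continuous_fst).prodMk
        (continuous_subtype_val.comp continuous_snd)))
  · exact continuous_const

end

namespace WhitneyJet
variable {d m : ℕ} {X : Compacts (Euc d)}

instance : AddCommGroup (WhitneyJet m X) := inferInstanceAs (AddCommGroup (whitneySubmodule m X))
instance : Module ℂ (WhitneyJet m X) := inferInstanceAs (Module ℂ (whitneySubmodule m X))

/-- The pairs of distinct points of `X`. -/
abbrev DistinctPairs (X : Compacts (Euc d)) : Type := {p : X × X // p.1 ≠ p.2}

/-- `|F|_m^X = sup_{x ∈ X, |k| ≤ m} |f^k(x)|`. -/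
def supNorm (F : WhitneyJet m X) : ℝ := ⨆ q : X × MultiIndex d m, ‖F.1 q.2 q.1‖

/-- `sup_{x ≠ y, |k| ≤ m} |(R^m_x F)^k(y)| / |x - y|^{m - |k|}` -/
def remNorm (F : WhitneyJet m X) : ℝ :=
  ⨆ q : DistinctPairs X × MultiIndex d m,
    ‖remainder F.1 q.1.1.1 q.2 q.1.1.2‖ / dist q.1.1.1 q.1.1.2 ^ (m - ∑ i, q.2.1 i)

theorem bddAbove_supNorm (F : WhitneyJet m X) :
    BddAbove (Set.range fun q : X × MultiIndex d m => ‖F.1 q.2 q.1‖) := by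
  obtain ⟨M, hM⟩ := (Set.finite_range fun k => ‖F.1 k‖).bddAbove
  exact ⟨M, by rintro _ ⟨⟨x, k⟩, rfl⟩; exact ((F.1 k).norm_coe_le_norm x).trans (hM ⟨k, rfl⟩)⟩

theorem bddAbove_remNorm (F : WhitneyJet m X) :
    BddAbove (Set.range fun q : DistinctPairs X × MultiIndex d m =>
      ‖remainder F.1 q.1.1.1 q.2 q.1.1.2‖ / dist q.1.1.1 q.1.1.2 ^ (m - ∑ i, q.2.1 i)) := by
  have h : ∀ k : MultiIndex d m, ∃ C, ∀ p : DistinctPairs X,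
      ‖remainder F.1 p.1.1 k p.1.2‖ / dist p.1.1 p.1.2 ^ (m - ∑ i, k.1 i) ≤ C := by
    intro k
    obtain ⟨δ, hδ, h1⟩ := Metric.mem_uniformity_dist.1 ((F.2 k).bound one_pos)
    obtain ⟨C, hC⟩ := isCompact_univ.exists_bound_of_continuousOn
      (continuous_remainder F.1 k).continuousOn
    refine ⟨max 1 (C / δ ^ (m - ∑ i, k.1 i)), fun p => ?_⟩
    have hp : 0 < dist p.1.1 p.1.2 := dist_pos.2 p.2
    by_cases hd : dist p.1.1 p.1.2 < δ
    · refine le_max_of_le_left ?_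
      have := h1 hd
      simp only [Set.mem_ofPred_eq, one_mul, norm_pow, Real.norm_of_nonneg hp.le] at this
      exact (div_le_one (pow_pos hp _)).2 this
    · refine le_max_of_le_right ?_
      have h0 := hC p.1 (Set.mem_univ _)
      have := (norm_nonneg _).trans h0
      have := not_lt.1 hd
      gcongr
  choose C hC using h
  obtain ⟨M, hM⟩ := (Set.finite_range C).bddAbove
  exact ⟨M, by rintro _ ⟨⟨p, k⟩, rfl⟩; exact (hC k p).trans (hM ⟨k, rfl⟩)⟩

/-- `‖F‖_m^X = |F|_m^X + sup_{x ≠ y, |k| ≤ m} |(R^m_x F)^k(y)| / |x - y|^{m - |k|}` -/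
instance : Norm (WhitneyJet m X) := ⟨fun F => supNorm F + remNorm F⟩

theorem supNorm_nonneg (F : WhitneyJet m X) : 0 ≤ supNorm F :=
  Real.iSup_nonneg fun _ => norm_nonneg _

theorem remNorm_nonneg (F : WhitneyJet m X) : 0 ≤ remNorm F :=
  Real.iSup_nonneg fun _ => by positivity

theorem norm_core (m : ℕ) (X : Compacts (Euc d)) : NormedSpace.Core ℂ (WhitneyJet m X) where
  norm_nonneg F := add_nonneg (supNorm_nonneg F) (remNorm_nonneg F)
  norm_smul c F := by
    show supNorm _ + remNorm _ = ‖c‖ * (supNorm F + remNorm F)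
    rw [mul_add]
    congr 1
    · rw [supNorm, supNorm, Real.mul_iSup_of_nonneg (norm_nonneg c)]
      congr 1; funext q
      exact norm_smul c (F.1 q.2 q.1)
    · rw [remNorm, remNorm, Real.mul_iSup_of_nonneg (norm_nonneg c)]
      congr 1; funext q
      have h : remainder (c • F).1 q.1.1.1 = c • remainder F.1 q.1.1.1 := remainder_smul c F.1 _
      rw [h, ← mul_div_assoc]
      congr 1
      exact norm_smul c (remainder F.1 q.1.1.1 q.2 q.1.1.2)
  norm_triangle F G := by
    show supNorm _ + remNorm _ ≤ (supNorm F + remNorm F) + (supNorm G + remNorm G)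
    have h1 : supNorm (F + G) ≤ supNorm F + supNorm G :=
      Real.iSup_le (fun q => (norm_add_le (F.1 q.2 q.1) (G.1 q.2 q.1)).trans
        (add_le_add (le_ciSup (bddAbove_supNorm F) q) (le_ciSup (bddAbove_supNorm G) q)))
        (add_nonneg (supNorm_nonneg F) (supNorm_nonneg G))
    have h2 : remNorm (F + G) ≤ remNorm F + remNorm G := by
      refine Real.iSup_le (fun q => ?_) (add_nonneg (remNorm_nonneg F) (remNorm_nonneg G))
      have h : remainder (F + G).1 q.1.1.1 = remainder F.1 q.1.1.1 + remainder G.1 q.1.1.1 :=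
        remainder_add F.1 G.1 _
      rw [h]
      refine le_trans ?_
        (add_le_add (le_ciSup (bddAbove_remNorm F) q) (le_ciSup (bddAbove_remNorm G) q))
      rw [← add_div]
      gcongr
      exact norm_add_le (remainder F.1 q.1.1.1 q.2 q.1.1.2) (remainder G.1 q.1.1.1 q.2 q.1.1.2)
    linarith
  norm_eq_zero_iff F := by
    constructor
    · intro h
      have h0 : supNorm F = 0 := by
        have h' : supNorm F + remNorm F = 0 := h
        linarith [supNorm_nonneg F, remNorm_nonneg F]
      refine Subtype.ext (funext fun k => ContinuousMap.ext fun x => ?_)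
      have := le_ciSup (bddAbove_supNorm F) (x, k)
      exact norm_le_zero_iff.1 (this.trans h0.le)
    · rintro rfl
      have h1 : supNorm (0 : WhitneyJet m X) = 0 := by
        have : (fun q : X × MultiIndex d m => ‖(0 : WhitneyJet m X).1 q.2 q.1‖) = fun _ => 0 := by
          funext q; exact norm_zero
        rw [supNorm, this, Real.iSup_const_zero]
      have h2 : remNorm (0 : WhitneyJet m X) = 0 := by
        have h : ∀ a : X, remainder (0 : WhitneyJet m X).1 a = 0 := fun a => remainder_zero a
        simp only [remNorm, h]
        simp
      show supNorm _ + remNorm _ = 0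
      rw [h1, h2, add_zero]

instance : NormedAddCommGroup (WhitneyJet m X) := NormedAddCommGroup.ofCore (norm_core m X)
instance : NormedSpace ℂ (WhitneyJet m X) := NormedSpace.ofCore (norm_core m X)

end WhitneyJet

section
variable {d m : ℕ}

theorem foldr_pd_taylorPoly_self {f : Cm d m} {X : Compacts (Euc d)} (a : X) (L : List (Fin d))
    (hL : L.length ≤ m) :
    L.foldr pd (taylorPoly (jetOf X f) a) a = L.foldr pd f a := by
  rw [foldr_pd_taylorPoly _ _ _ hL, foldr_pd_eq_partialDeriv f.contDiff L hL]
  rw [Finset.sum_eq_single ⟨fun i => L.count i, by rw [sum_count]; exact hL⟩]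
  · have : (fun j => L.count j - L.count j) = (0 : Fin d → ℕ) := by funext j; simp
    simp only [le_refl, implies_true, if_true, taylorMonomial_self, this]
    simp [jetOf]
  · intro k _ hk
    split_ifs with h
    · rw [taylorMonomial_self, if_neg]
      · simp
      · intro h0
        refine hk (Subtype.ext (funext fun i => le_antisymm ?_ (h i)))
        have h1 : k.1 i - L.count i = 0 := congrFun h0 i
        show k.1 i ≤ L.count i
        omega
    · simp
  · simp

theorem foldr_pd_taylorPoly_top {f : Cm d m} {X : Compacts (Euc d)} (a : X) (L : List (Fin d))
    (hL : L.length = m) (z : Euc d) :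
    L.foldr pd (taylorPoly (jetOf X f) a) z = L.foldr pd f a := by
  rw [foldr_pd_taylorPoly _ _ _ hL.le, foldr_pd_eq_partialDeriv f.contDiff L hL.le]
  rw [Finset.sum_eq_single ⟨fun i => L.count i, by rw [sum_count]; exact hL.le⟩]
  · have : (fun j => L.count j - L.count j) = (0 : Fin d → ℕ) := by funext j; simp
    simp only [le_refl, implies_true, if_true, this]
    simp [jetOf, taylorMonomial]
  · intro k _ hk
    rw [if_neg, zero_mul]
    intro h
    refine hk (Subtype.ext (funext fun i => le_antisymm ?_ (h i)))
    have h1 := sum_count L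
    have h2 := k.2
    by_contra hlt
    have : ∑ i, L.count i < ∑ i, k.1 i :=
      Finset.sum_lt_sum (fun i _ => h i) ⟨i, Finset.mem_univ _, not_le.1 hlt⟩
    omega
  · simp

end

section
variable {d m : ℕ}

theorem iteratedFDeriv_single_eq {n : ℕ} {f : Euc d → ℂ} (hf : ContDiff ℝ m f) (hn : n ≤ m)
    (s : Fin n → Fin d) (x : Euc d) :
    iteratedFDeriv ℝ n f x (fun j => EuclideanSpace.single (s j) 1) =
      (List.ofFn s).foldr pd f x := by
  have key : ∀ (L : List (Fin d)) (h : L.length = n), (∀ j, L.get (Fin.cast h.symm j) = s j) →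
      iteratedFDeriv ℝ n f x (fun j => EuclideanSpace.single (s j) 1) = L.foldr pd f x := by
    intro L h hs
    subst h
    rw [foldr_pd_eq_iteratedFDeriv hf L hn]
    congr 1
    funext j
    rw [← hs j]
    rfl
  exact key (List.ofFn s) (List.length_ofFn) (fun j => by simp)

theorem norm_iteratedFDeriv_le {f : Euc d → ℂ} (hf : ContDiff ℝ m f) {n : ℕ} (hn : n ≤ m)
    {x : Euc d} {M : ℝ} (hM : ∀ L : List (Fin d), L.length = n → ‖L.foldr pd f x‖ ≤ M) :
    ‖iteratedFDeriv ℝ n f x‖ ≤ (d : ℝ) ^ n * M := by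
  refine (norm_le_sum_apply_single _).trans ?_
  refine (Finset.sum_le_card_nsmul _ _ M fun s _ => ?_).trans ?_
  · rw [iteratedFDeriv_single_eq hf hn]
    exact hM _ List.length_ofFn
  · simp

theorem norm_remainder_jetOf_le (f : Cm d m) {X : Compacts (Euc d)} (a y : X)
    (k : MultiIndex d m) {M : ℝ}
    (hM : ∀ z ∈ segment ℝ (a : Euc d) y, ∀ L : List (Fin d), L.length = m →
      ‖L.foldr pd f z - L.foldr pd f a‖ ≤ M) :
    ‖remainder (jetOf X f) a k y‖ ≤ (d : ℝ) ^ m * M * dist a y ^ (m - ∑ i, k.1 i) := by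
  set T := taylorPoly (jetOf X f) a
  set g : Euc d → ℂ := ((f : Cm d m) : Euc d → ℂ) + (-1 : ℂ) • (T : Euc d → ℂ) with hg
  have hT' : ContDiff ℝ m ((-1 : ℂ) • (T : Euc d → ℂ)) := T.contDiff.const_smul (-1 : ℂ)
  have hgc : ContDiff ℝ m g := f.contDiff.add hT'
  have hfold : ∀ L : List (Fin d), L.length ≤ m → ∀ z,
      L.foldr pd g z = L.foldr pd f z - L.foldr pd T z := by
    intro L hL z
    rw [hg, foldr_pd_add f.contDiff hT' L hL, foldr_pd_smul _ T.contDiff L hL]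
    simp [sub_eq_add_neg]
  have hM0 : 0 ≤ M ∨ d = 0 := by
    by_cases hd : d = 0
    · exact Or.inr hd
    · exact Or.inl ((norm_nonneg _).trans (hM a (left_mem_segment _ _ _)
        (List.replicate m ⟨0, Nat.pos_of_ne_zero hd⟩) (by simp)))
  have hB : 0 ≤ (d : ℝ) ^ m * M := by
    by_cases hm : m = 0
    · subst hm
      have := (norm_nonneg _).trans (hM a (left_mem_segment _ _ _) [] rfl)
      simpa using this
    · rcases hM0 with h | h
      · positivity
      · subst h; simp [hm]
  have hvan : ∀ n ≤ m, iteratedFDeriv ℝ n g a = 0 := by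
    intro n hn
    refine norm_le_zero_iff.1 ((norm_iteratedFDeriv_le hgc hn (M := 0) fun L hL => ?_).trans
      (by simp))
    rw [hfold L (hL.le.trans hn), foldr_pd_taylorPoly_self a L (hL.le.trans hn), sub_self, norm_zero]
  have hmain : ∀ i ≤ m, ∀ z ∈ segment ℝ (a : Euc d) y,
      ‖iteratedFDeriv ℝ (m - i) g z‖ ≤ (d : ℝ) ^ m * M * dist (a : Euc d) y ^ i := by
    intro i
    induction i with
    | zero =>
      intro _ z hz
      simp only [Nat.sub_zero, pow_zero, mul_one]
      refine norm_iteratedFDeriv_le hgc le_rfl fun L hL => ?_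
      rw [hfold L hL.le, foldr_pd_taylorPoly_top a L hL]
      exact hM z hz L hL
    | succ i ih =>
      intro hi z hz
      obtain ⟨n, hn⟩ : ∃ n, m - i = n + 1 := ⟨m - i - 1, by omega⟩
      have hn' : m - (i + 1) = n := by omega
      rw [hn] at ih
      rw [hn']
      have h := (convex_segment (a : Euc d) (y : Euc d)).norm_image_sub_le_of_norm_fderiv_le
        (𝕜 := ℝ) (f := iteratedFDeriv ℝ n g)
        (fun w _ => hgc.differentiable_iteratedFDeriv (by exact_mod_cast (by omega : n < m)) w)
        (fun w hw => by rw [norm_fderiv_iteratedFDeriv]; exact ih (by omega) w hw)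
        (left_mem_segment ℝ (a : Euc d) y) hz
      rw [hvan n (by omega), sub_zero] at h
      refine h.trans ?_
      rw [pow_succ, ← mul_assoc]
      have : ‖z - a‖ ≤ dist (a : Euc d) y := by
        rw [dist_eq_norm, ← norm_neg ((a : Euc d) - y), neg_sub]
        obtain ⟨t, ht, rfl⟩ := segment_eq_image' ℝ (a : Euc d) y ▸ hz
        simp only [add_sub_cancel_left, norm_smul, Real.norm_of_nonneg ht.1]
        exact mul_le_of_le_one_left (norm_nonneg _) ht.2
      gcongr
  have hrem : remainder (jetOf X f) a k y = (indexList k.1).foldr pd g y := by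
    rw [hfold _ (by rw [length_indexList]; exact k.2)]
    rfl
  have hlen : (indexList k.1).length = m - (m - ∑ i, k.1 i) := by
    rw [length_indexList]
    have := k.2
    omega
  rw [hrem, foldr_pd_eq_iteratedFDeriv hgc _ (by rw [length_indexList]; exact k.2)]
  refine (ContinuousMultilinearMap.le_opNorm _ _).trans ?_
  have h1 : ∏ j : Fin (indexList k.1).length,
      ‖(EuclideanSpace.single ((indexList k.1).get j) 1 : Euc d)‖ = 1 := by simp
  rw [h1, mul_one, hlen]
  exact hmain _ (Nat.sub_le _ _) y (right_mem_segment _ _ _)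

theorem exists_closedBall (X : Compacts (Euc d)) :
    ∃ K : Compacts (Euc d), Convex ℝ (K : Set (Euc d)) ∧ (X : Set (Euc d)) ⊆ K := by
  obtain ⟨r, hr⟩ := X.isCompact.isBounded.subset_closedBall 0
  exact ⟨⟨Metric.closedBall 0 r, isCompact_closedBall _ _⟩, convex_closedBall _ _, hr⟩

theorem isWhitney_jetOf (X : Compacts (Euc d)) (f : Cm d m) : IsWhitney (jetOf X f) := by
  obtain ⟨K, hKc, hXK⟩ := exists_closedBall X
  intro k
  refine isLittleO_iff.2 fun c hc => ?_
  let D : Euc d → (Fin m → Fin d) → ℂ := fun z s => (List.ofFn s).foldr pd f z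
  have hD : Continuous D := continuous_pi fun s =>
    (contDiff_foldr_pd' (n := 0) (m := m) (List.ofFn s) (by simp) f.contDiff).continuous
  have hu := K.isCompact.uniformContinuousOn_of_continuous hD.continuousOn
  have hε : 0 < c / ((d : ℝ) ^ m + 1) := by positivity
  obtain ⟨δ, hδ, h⟩ := Metric.uniformContinuousOn_iff.1 hu _ hε
  refine Metric.mem_uniformity_dist.2 ⟨δ, hδ, fun x y hxy => ?_⟩
  have hM := norm_remainder_jetOf_le f x y k (M := c / ((d : ℝ) ^ m + 1)) fun z hz L hL => by
    have hzK : z ∈ K := hKc.segment_subset (hXK x.2) (hXK y.2) hz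
    have hd : dist z (x : Euc d) < δ := by
      refine lt_of_le_of_lt ?_ hxy
      have h1 := dist_add_dist_of_mem_segment hz
      have h2 : dist x y = dist (x : Euc d) y := rfl
      rw [h2, dist_comm z]
      linarith [dist_nonneg (x := z) (y := (y : Euc d))]
    have h3 := (dist_le_pi_dist (D z) (D x) (fun j => L.get (Fin.cast hL.symm j))).trans
      (h z hzK x (hXK x.2) hd).le
    subst hL
    simpa [D, dist_eq_norm] using h3
  refine hM.trans ?_
  rw [Real.norm_of_nonneg (by positivity : (0 : ℝ) ≤ dist x y ^ _)]
  gcongr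
  rw [← mul_div_assoc, div_le_iff₀ (by positivity)]
  nlinarith [pow_nonneg (Nat.cast_nonneg (α := ℝ) d) m]

theorem foldr_pd_le_seminorm (f : Cm d m) (K : Compacts (Euc d)) {z : Euc d} (hz : z ∈ K)
    (L : List (Fin d)) (hL : L.length ≤ m) :
    ‖L.foldr pd f z‖ ≤ Cm.seminorm d m (K, Fin.last m) f := by
  rw [foldr_pd_eq_partialDeriv f.contDiff L hL]
  exact le_ciSup (Cm.bddAbove_seminorm K (Fin.last m) f)
    (⟨z, hz⟩, ⟨fun i => L.count i, by rw [sum_count]; exact hL⟩)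

/-- The jet map `J^m : E^m(ℝ^d) → E^m(X)`, `g ↦ (∂^k g|_X)_{|k| ≤ m}`, as a continuous linear map. -/
def jetMap (m : ℕ) (X : Compacts (Euc d)) : Cm d m →L[ℂ] WhitneyJet m X where
  toLinearMap := (jetOf X).codRestrict (whitneySubmodule m X) (isWhitney_jetOf X)
  cont := by
    obtain ⟨K, hKc, hXK⟩ := exists_closedBall X
    refine WithSeminorms.continuous_normedSpace_rng (𝕝₂ := ℂ) (WhitneyJet m X) (Cm.withSeminorms d m)
      ((jetOf X).codRestrict (whitneySubmodule m X) (isWhitney_jetOf X)) ?_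
    refine ⟨{(K, Fin.last m)}, 1 + (d : NNReal) ^ m * 2, fun f => ?_⟩
    rw [Finset.sup_singleton]
    set p := Cm.seminorm d m (K, Fin.last m) f with hp
    have hp0 : 0 ≤ p := apply_nonneg _ _
    have h1 : WhitneyJet.supNorm (⟨jetOf X f, isWhitney_jetOf X f⟩ : WhitneyJet m X) ≤ p :=
      Real.iSup_le (fun q => foldr_pd_le_seminorm f K (hXK q.1.2) (indexList q.2.1)
        (by rw [length_indexList]; exact q.2.2)) hp0
    have h2 : WhitneyJet.remNorm (⟨jetOf X f, isWhitney_jetOf X f⟩ : WhitneyJet m X) ≤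
        (d : ℝ) ^ m * (2 * p) := by
      refine Real.iSup_le (fun q => ?_) (by positivity)
      have hq : 0 < dist q.1.1.1 q.1.1.2 := dist_pos.2 q.1.2
      rw [div_le_iff₀ (pow_pos hq _)]
      refine norm_remainder_jetOf_le f _ _ _ fun z hz L hL => (norm_sub_le _ _).trans ?_
      have := foldr_pd_le_seminorm f K (hKc.segment_subset (hXK q.1.1.1.2) (hXK q.1.1.2.2) hz)
        L hL.le
      have := foldr_pd_le_seminorm f K (hXK q.1.1.1.2) L hL.le
      linarith
    show WhitneyJet.supNorm (⟨jetOf X f, isWhitney_jetOf X f⟩ : WhitneyJet m X) +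
      WhitneyJet.remNorm (⟨jetOf X f, isWhitney_jetOf X f⟩ : WhitneyJet m X) ≤ _
    have h3 : ((1 + (d : NNReal) ^ m * 2) • Cm.seminorm d m (K, Fin.last m)) f =
        (1 + (d : ℝ) ^ m * 2) * p := by
      show (1 + (d : NNReal) ^ m * 2) • p = _
      rw [NNReal.smul_def, smul_eq_mul]
      push_cast
      rfl
    rw [h3]
    linarith

end

/-- The transpose `Λ' : F' → E'`, `φ ↦ φ ∘ Λ`, of a continuous linear map `Λ : E → F`; the duals
carry the weak star topology. -/
def transpose {E F : Type*} [AddCommGroup E] [Module ℂ E] [TopologicalSpace E]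
    [AddCommGroup F] [Module ℂ F] [TopologicalSpace F] (Λ : E →L[ℂ] F) :
    WeakDual ℂ F →L[ℂ] WeakDual ℂ E where
  toFun φ := StrongDual.toWeakDual ((WeakDual.toStrongDual φ).comp Λ)
  map_add' _ _ := rfl
  map_smul' _ _ := rfl
  cont := WeakDual.continuous_of_continuous_eval fun x => WeakDual.eval_continuous (Λ x)

/-- The sequence `0 → A → B → C → 0` is exact. -/
def IsShortExact {A B C : Type*} [AddCommGroup A] [Module ℂ A] [TopologicalSpace A]
    [AddCommGroup B] [Module ℂ B] [TopologicalSpace B]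
    [AddCommGroup C] [Module ℂ C] [TopologicalSpace C] (f : A →L[ℂ] B) (g : B →L[ℂ] C) : Prop :=
  Function.Injective f ∧ Function.Exact f g ∧ Function.Surjective g

section
variable {d : ℕ}

/-- `I^m(X, ℝ^d)`: the `C^m` functions that vanish on `X` together with all their derivatives of
order at most `m`, with the topology induced by `E^m(ℝ^d)`. -/
def flatFunctions (m : ℕ) (X : Compacts (Euc d)) : Submodule ℂ (Cm d m) where
  carrier := {f | ∀ x ∈ X, ∀ ν : Fin d → ℕ, ∑ i, ν i ≤ m → partialDeriv ν f x = 0}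
  add_mem' {f g} hf hg x hx ν hν := by
    have h : partialDeriv ν (f + g : Cm d m) = partialDeriv ν f + partialDeriv ν g :=
      partialDeriv_add f.contDiff g.contDiff ν hν
    rw [h, Pi.add_apply, hf x hx ν hν, hg x hx ν hν, add_zero]
  zero_mem' x hx ν hν := by
    have h : partialDeriv ν (0 : Cm d m) = 0 := by
      have := partialDeriv_smul (0 : ℂ) (0 : Cm d m).contDiff ν hν
      rw [zero_smul, zero_smul] at this
      exact this
    rw [h, Pi.zero_apply]
  smul_mem' c f hf x hx ν hν := by
    have h : partialDeriv ν (c • f : Cm d m) = c • partialDeriv ν f :=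
      partialDeriv_smul c f.contDiff ν hν
    rw [h, Pi.smul_apply, hf x hx ν hν, smul_zero]

/-- The inclusion `i : I^m(X, ℝ^d) → E^m(ℝ^d)`. -/
def flatIncl (m : ℕ) (X : Compacts (Euc d)) : flatFunctions m X →L[ℂ] Cm d m :=
  (flatFunctions m X).subtypeL

/-- Renormalization schemes: the closed subspaces `D` with `E^m(ℝ^d) = I^m(X, ℝ^d) ⊕ D`. -/
def RenormScheme (m : ℕ) (X : Compacts (Euc d)) : Type :=
  {D : Submodule ℂ (Cm d m) // IsClosed (D : Set (Cm d m)) ∧ IsCompl (flatFunctions m X) D}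

/-- Continuous linear sections `T : E^m(X) → E^m(ℝ^d)` of `J^m`. -/
def JetSection (m : ℕ) (X : Compacts (Euc d)) : Type :=
  {T : WhitneyJet m X →L[ℂ] Cm d m // ∀ G, jetMap m X (T G) = G}

/-- Renormalization sections: continuous linear sections `R : I^m(X, ℝ^d)' → E^m(ℝ^d)'` of `i'`,
for the weak star topologies. -/
def RenormSection (m : ℕ) (X : Compacts (Euc d)) : Type :=
  {R : WeakDual ℂ (flatFunctions m X) →L[ℂ] WeakDual ℂ (Cm d m) //
    ∀ τ, transpose (flatIncl m X) (R τ) = τ}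

end

end Whitney

end

open Whitney

/-!
The heart of the matter is Whitney's extension theorem in its linear form: the jet map has a
continuous linear section. Outside `X` the extension of a jet `F` is `∑ θ_i T_{a_i} F`, for a smooth
partition of unity `θ_i` on the complement of `X` whose members have supports of a size comparable to
their distance from `X`, and points `a_i ∈ X` close to these supports. The partition is built from
lattice bumps at all scales `2⁻ⁿ`, multiplied by differences of cutoffs at consecutive scales
(`exists_whitney_partition`). The change of the Taylor polynomial with its base point is the Taylor
polynomial of the remainder (`taylorPoly_sub_taylorPoly`), so that the extension and its derivatives
are as close to a Taylor polynomial as the Whitney condition says (`exists_bound_extendDeriv_sub`).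
This shows both that the extension is of class `C^m` with the right jet, and that it depends
continuously on the jet (`nonempty_jetSection`).

Given one section `T`, the projection `φ ↦ φ - T (J^m φ)` splits the first sequence, hence also its
transpose. A closed complement `D` of the flat functions determines a linear section of the jet map
with range `D`, and its continuity is a case of the closed graph theorem for maps from a Banach space
to a Fréchet space (`bound_of_seq_closed_graph`, `continuous_of_section`). A section of `i'` that is
continuous for the weak star topologies is a transpose, because weak star continuous functionals are
evaluations (`RenormSection.exists_proj`); so the annihilator of its range is a closed complement.
These passages `RenormSection.toScheme`, `RenormScheme.toSection` and `JetSection.toRenormSection`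
compose to the identity all the way around, which gives the two bijections.
-/

noncomputable section

open TopologicalSpace Uniformity Asymptotics

namespace Whitney

/-! ### Partial derivatives and differentials -/

section
variable {d m : ℕ}

/-- The real linear map `ℝ^d → ℂ` that sends the `i`-th basis vector to `v i`. -/
def gradCLM (v : Fin d → ℂ) : Euc d →L[ℝ] ℂ :=
  ∑ i, (EuclideanSpace.proj i : Euc d →L[ℝ] ℝ).smulRight (v i)

theorem gradCLM_apply (v : Fin d → ℂ) (x : Euc d) : gradCLM v x = ∑ i, x i • v i := by
  simp [gradCLM]

theorem gradCLM_single (v : Fin d → ℂ) (i : Fin d) :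
    gradCLM v (EuclideanSpace.single i 1) = v i := by
  rw [gradCLM_apply, Finset.sum_eq_single i] <;> simp +contextual

theorem eq_gradCLM (A : Euc d →L[ℝ] ℂ) : A = gradCLM fun i => A (EuclideanSpace.single i 1) := by
  ext x
  have hx : x = ∑ i, x i • (EuclideanSpace.single i 1 : Euc d) := by
    ext k; simp [Pi.single_apply]
  rw [gradCLM_apply]
  conv_lhs => rw [hx]
  simp

theorem norm_gradCLM_le (v : Fin d → ℂ) : ‖gradCLM v‖ ≤ ∑ i, ‖v i‖ := by
  refine ContinuousLinearMap.opNorm_le_bound _ (by positivity) fun x => ?_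
  rw [gradCLM_apply, Finset.sum_mul]
  refine (norm_sum_le _ _).trans (Finset.sum_le_sum fun i _ => ?_)
  rw [norm_smul, mul_comm]
  gcongr
  exact PiLp.norm_apply_le x i

theorem continuous_gradCLM : Continuous (gradCLM : (Fin d → ℂ) → Euc d →L[ℝ] ℂ) := by
  unfold gradCLM
  refine continuous_finsetSum _ fun i _ => ?_
  exact ((ContinuousLinearMap.smulRightL ℝ (Euc d) ℂ (EuclideanSpace.proj i)).continuous).comp
    (continuous_apply i)

theorem contDiff_gradCLM {n : WithTop ℕ∞} {v : Fin d → Euc d → ℂ} (hv : ∀ i, ContDiff ℝ n (v i)) :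
    ContDiff ℝ n fun x => gradCLM fun i => v i x := by
  unfold gradCLM
  refine ContDiff.sum fun i _ => ?_
  exact (ContinuousLinearMap.smulRightL ℝ (Euc d) ℂ (EuclideanSpace.proj i)).contDiff.comp (hv i)

theorem gradCLM_tsum {v : ℕ → Fin d → ℂ} (hv : ∀ i, Summable fun j => v j i) :
    gradCLM (fun i => ∑' j, v j i) = ∑' j, gradCLM (v j) := by
  have hp : HasSum v (fun i => ∑' j, v j i) := Pi.hasSum.2 fun i => (hv i).hasSum
  have hlin : IsLinearMap ℝ (gradCLM : (Fin d → ℂ) → Euc d →L[ℝ] ℂ) :=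
    ⟨fun v w => by ext x; simp [gradCLM_apply, Finset.sum_add_distrib],
      fun c v => by ext x; simp [gradCLM_apply, Finset.mul_sum, mul_left_comm]⟩
  exact (hp.map (IsLinearMap.mk' _ hlin) continuous_gradCLM).tsum_eq.symm

theorem sum_add_single (ν : Fin d → ℕ) (i : Fin d) :
    ∑ j, (ν + Pi.single i 1 : Fin d → ℕ) j = ∑ j, ν j + 1 := by
  simp [Finset.sum_add_distrib]

theorem count_cons_eq (L : List (Fin d)) (i : Fin d) :
    (fun j => (i :: L).count j) = (fun j => L.count j) + Pi.single i 1 := by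
  funext j
  by_cases h : j = i
  · subst h; simp
  · simp [h, Ne.symm h]

/-- If the members of a family `g^ν`, `|ν| ≤ m`, are continuous and `g^ν` has the partial derivatives
`g^{ν + e_i}` for `|ν| < m`, then `g^ν` is of class `C^{m - |ν|}`. -/
theorem contDiff_of_hasFDerivAt_family {g : (Fin d → ℕ) → Euc d → ℂ}
    (hc : ∀ ν, ∑ i, ν i ≤ m → Continuous (g ν))
    (hd : ∀ ν, ∑ i, ν i < m → ∀ x, HasFDerivAt (g ν) (gradCLM fun i => g (ν + Pi.single i 1) x) x)
    (n : ℕ) (ν : Fin d → ℕ) (hν : n + ∑ i, ν i ≤ m) : ContDiff ℝ n (g ν) := by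
  induction n generalizing ν with
  | zero => exact contDiff_zero.2 (hc ν (by omega))
  | succ n ih =>
    refine contDiff_succ_iff_hasFDerivAt.2
      ⟨fun x => gradCLM fun i => g (ν + Pi.single i 1) x, ?_, hd ν (by omega)⟩
    refine contDiff_gradCLM fun i => ih _ ?_
    rw [sum_add_single]; omega

theorem foldr_pd_of_hasFDerivAt_family {g : (Fin d → ℕ) → Euc d → ℂ}
    (hd : ∀ ν, ∑ i, ν i < m → ∀ x, HasFDerivAt (g ν) (gradCLM fun i => g (ν + Pi.single i 1) x) x)
    (L : List (Fin d)) (hL : L.length ≤ m) : L.foldr pd (g 0) = g fun i => L.count i := by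
  induction L with
  | nil => simp; rfl
  | cons i L ih =>
    simp only [List.length_cons] at hL
    rw [List.foldr_cons, ih (by omega), count_cons_eq]
    funext x
    rw [pd, (hd _ (by rw [sum_count]; omega) x).fderiv, gradCLM_single]

theorem partialDeriv_of_hasFDerivAt_family {g : (Fin d → ℕ) → Euc d → ℂ}
    (hd : ∀ ν, ∑ i, ν i < m → ∀ x, HasFDerivAt (g ν) (gradCLM fun i => g (ν + Pi.single i 1) x) x)
    (ν : Fin d → ℕ) (hν : ∑ i, ν i ≤ m) : partialDeriv ν (g 0) = g ν := by
  rw [partialDeriv, foldr_pd_of_hasFDerivAt_family hd _ (by rwa [length_indexList])]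
  congr 1
  funext i
  exact count_indexList ν i

theorem partialDeriv_zero_index (f : Euc d → ℂ) : partialDeriv 0 f = f := by
  have h : (indexList (0 : Fin d → ℕ)).length = 0 := by rw [length_indexList]; simp
  rw [partialDeriv, List.eq_nil_of_length_eq_zero h]
  rfl

theorem hasFDerivAt_partialDeriv {f : Euc d → ℂ} (hf : ContDiff ℝ m f) (ν : Fin d → ℕ)
    (hν : ∑ i, ν i < m) (x : Euc d) :
    HasFDerivAt (partialDeriv ν f) (gradCLM fun i => partialDeriv (ν + Pi.single i 1) f x) x := by
  have h1 : ContDiff ℝ (1 : ℕ) (partialDeriv ν f) :=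
    contDiff_foldr_pd' (indexList ν) (by rw [length_indexList]; omega) hf
  have h2 := (h1.differentiable (by norm_num) x).hasFDerivAt
  have h3 : (fun i => partialDeriv (ν + Pi.single i 1) f x) =
      fun i => fderiv ℝ (partialDeriv ν f) x (EuclideanSpace.single i 1) := by
    funext i
    show _ = (i :: indexList ν).foldr pd f x
    rw [foldr_pd_eq_partialDeriv hf _ (by simp [length_indexList]; omega), count_cons_eq]
    congr 3
    funext j
    exact (count_indexList ν j).symm
  rw [h3, ← eq_gradCLM]
  exact h2

theorem foldr_pd_congr {f g : Euc d → ℂ} {x : Euc d} (h : f =ᶠ[nhds x] g) (L : List (Fin d)) :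
    L.foldr pd f =ᶠ[nhds x] L.foldr pd g := by
  induction L with
  | nil => exact h
  | cons i L ih =>
    filter_upwards [ih.fderiv (𝕜 := ℝ)] with y hy
    simp only [List.foldr_cons, pd, hy]

theorem norm_partialDeriv_le_iteratedFDeriv {f : Euc d → ℂ} (hf : ContDiff ℝ m f) (ν : Fin d → ℕ)
    (hν : ∑ i, ν i ≤ m) (x : Euc d) :
    ‖partialDeriv ν f x‖ ≤ ‖iteratedFDeriv ℝ (∑ i, ν i) f x‖ := by
  rw [partialDeriv, foldr_pd_eq_iteratedFDeriv hf _ (by rwa [length_indexList])]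
  refine (ContinuousMultilinearMap.le_opNorm _ _).trans ?_
  rw [← length_indexList]
  simp

/-! ### The Fréchet space of `C^m` functions -/

namespace Cm

theorem seminorm_le {K : Compacts (Euc d)} {k : Fin (m + 1)} {f : Cm d m} {C : ℝ} (hC : 0 ≤ C)
    (h : ∀ x ∈ K, ∀ ν : Fin d → ℕ, ∑ i, ν i ≤ k → ‖partialDeriv ν f x‖ ≤ C) :
    seminorm d m (K, k) f ≤ C :=
  Real.iSup_le (fun p => h p.1 p.1.2 p.2.1 p.2.2) hC

theorem norm_partialDeriv_le (K : Compacts (Euc d)) (k : Fin (m + 1)) (f : Cm d m) {x : Euc d}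
    (hx : x ∈ K) (ν : Fin d → ℕ) (hν : ∑ i, ν i ≤ k) :
    ‖partialDeriv ν f x‖ ≤ seminorm d m (K, k) f :=
  le_ciSup (bddAbove_seminorm K k f) (⟨x, hx⟩, ⟨ν, hν⟩)

/-- The closed ball of radius `n` around the origin. -/
def ball (d n : ℕ) : Compacts (Euc d) := ⟨Metric.closedBall 0 n, isCompact_closedBall _ _⟩

/-- The seminorm `sup_{|x| ≤ n, |ν| ≤ m} |∂^ν f(x)|`; these seminorms define the topology. -/
def ballSeminorm (d m n : ℕ) : Seminorm ℂ (Cm d m) := seminorm d m (ball d n, Fin.last m)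

theorem norm_le_ballSeminorm (f : Cm d m) {n : ℕ} {x : Euc d} (hx : ‖x‖ ≤ n) (ν : Fin d → ℕ)
    (hν : ∑ i, ν i ≤ m) : ‖partialDeriv ν f x‖ ≤ ballSeminorm d m n f :=
  norm_partialDeriv_le (ball d n) (Fin.last m) f (mem_closedBall_zero_iff.2 hx) ν hν

theorem ballSeminorm_le {n : ℕ} {f : Cm d m} {C : ℝ} (hC : 0 ≤ C)
    (h : ∀ x : Euc d, ‖x‖ ≤ n → ∀ ν : Fin d → ℕ, ∑ i, ν i ≤ m → ‖partialDeriv ν f x‖ ≤ C) :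
    ballSeminorm d m n f ≤ C :=
  seminorm_le hC fun x hx => h x (mem_closedBall_zero_iff.1 hx)

theorem ballSeminorm_mono : Monotone (ballSeminorm d m) := fun n n' h f =>
  ballSeminorm_le (apply_nonneg _ _) fun _ hx ν hν =>
    norm_le_ballSeminorm f (hx.trans (by exact_mod_cast h)) ν hν

theorem exists_seminorm_le (q : Compacts (Euc d) × Fin (m + 1)) :
    ∃ n, seminorm d m q ≤ ballSeminorm d m n := by
  obtain ⟨r, hr⟩ := q.1.isCompact.isBounded.subset_closedBall 0
  obtain ⟨n, hn⟩ := exists_nat_ge r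
  refine ⟨n, fun f => seminorm_le (apply_nonneg _ _) fun x hx ν hν => ?_⟩
  refine norm_le_ballSeminorm f (le_trans ?_ hn) ν (hν.trans (Nat.lt_succ_iff.1 q.2.2))
  simpa using hr hx

theorem continuous_ballSeminorm (n : ℕ) : Continuous (ballSeminorm d m n) :=
  (withSeminorms d m).continuous_seminorm _

theorem tendsto_iff {ι : Type*} {l : Filter ι} (u : ι → Cm d m) (f : Cm d m) :
    Filter.Tendsto u l (nhds f) ↔
      ∀ n, Filter.Tendsto (fun i => ballSeminorm d m n (u i - f)) l (nhds 0) := by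
  constructor
  · intro h n
    have := ((continuous_ballSeminorm n).tendsto (f - f)).comp (h.sub_const f)
    simpa [Function.comp_def] using this
  · intro h
    rw [(withSeminorms d m).tendsto_nhds]
    intro q ε hε
    obtain ⟨n, hn⟩ := exists_seminorm_le q
    filter_upwards [(h n).eventually (gt_mem_nhds hε)] with i hi
    exact (hn _).trans_lt hi

/-- A linear map from a normed space is continuous if its composites with all seminorms
`ballSeminorm d m n` are bounded. -/
theorem continuous_of_bound {W : Type*} [NormedAddCommGroup W] [NormedSpace ℂ W]
    (S : W →ₗ[ℂ] Cm d m) (h : ∀ n, ∃ C, ∀ w, ballSeminorm d m n (S w) ≤ C * ‖w‖) :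
    Continuous S := by
  refine continuous_of_continuousAt_zero S ?_
  show Filter.Tendsto _ _ _
  rw [map_zero, tendsto_iff]
  intro n
  obtain ⟨C, hC⟩ := h n
  have h0 : Filter.Tendsto (fun w : W => C * ‖w‖) (nhds 0) (nhds 0) := by
    have : Continuous fun w : W => C * ‖w‖ := by fun_prop
    simpa using this.tendsto 0
  exact squeeze_zero (fun _ => apply_nonneg _ _) (fun w => by simpa using hC w) h0

theorem continuous_bound {W : Type*} [NormedAddCommGroup W] [NormedSpace ℂ W]
    (S : W →L[ℂ] Cm d m) (n : ℕ) : ∃ C, 0 ≤ C ∧ ∀ w, ballSeminorm d m n (S w) ≤ C * ‖w‖ := by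
  obtain ⟨C, _, hC⟩ := Seminorm.bound_of_continuous_normedSpace
    ((ballSeminorm d m n).comp S.toLinearMap) ((continuous_ballSeminorm n).comp S.continuous)
  exact ⟨C, by positivity, hC⟩

theorem partialDeriv_sum (u : ℕ → Cm d m) (s : Finset ℕ) (ν : Fin d → ℕ) (hν : ∑ i, ν i ≤ m) :
    partialDeriv ν (∑ i ∈ s, u i : Cm d m) = ∑ i ∈ s, partialDeriv ν (u i) := by
  induction s using Finset.cons_induction with
  | empty =>
    have := partialDeriv_smul (0 : ℂ) (0 : Cm d m).contDiff ν hν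
    rw [zero_smul, zero_smul] at this
    exact this
  | cons a s ha ih =>
    rw [Finset.sum_cons, Finset.sum_cons, ← ih]
    exact partialDeriv_add (u a).contDiff (∑ i ∈ s, u i : Cm d m).contDiff ν hν

theorem partialDeriv_sub (f g : Cm d m) (ν : Fin d → ℕ) (hν : ∑ i, ν i ≤ m) :
    partialDeriv ν (f - g : Cm d m) = partialDeriv ν f - partialDeriv ν g := by
  have h : (f - g : Cm d m) = f + (-1 : ℂ) • g := by rw [neg_one_smul, sub_eq_add_neg]
  have h1 : partialDeriv ν (f + (-1 : ℂ) • g : Cm d m) =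
      partialDeriv ν f + partialDeriv ν ((-1 : ℂ) • g : Cm d m) :=
    partialDeriv_add f.contDiff ((-1 : ℂ) • g : Cm d m).contDiff ν hν
  have h2 : partialDeriv ν ((-1 : ℂ) • g : Cm d m) = (-1 : ℂ) • partialDeriv ν g :=
    partialDeriv_smul (-1 : ℂ) g.contDiff ν hν
  rw [h, h1, h2, neg_one_smul, sub_eq_add_neg]

theorem exists_mem_ball (x : Euc d) : ∃ n : ℕ, x ∈ Metric.ball (0 : Euc d) n := by
  obtain ⟨n, hn⟩ := exists_nat_gt ‖x‖
  exact ⟨n, by simpa using hn⟩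

theorem norm_partialDeriv_le_of_mem_ball (f : Cm d m) {n : ℕ} {ν : Fin d → ℕ}
    (hν : ∑ i, ν i ≤ m) {x : Euc d} (hx : x ∈ Metric.ball (0 : Euc d) n) :
    ‖partialDeriv ν f x‖ ≤ ballSeminorm d m n f :=
  norm_le_ballSeminorm _ (mem_ball_zero_iff.1 hx).le ν hν

theorem summable_partialDeriv
    {u : ℕ → Cm d m} (hu : ∀ n, Summable fun j => ballSeminorm d m n (u j))
    {ν : Fin d → ℕ} (hν : ∑ i, ν i ≤ m) (x : Euc d) :
    Summable fun j => partialDeriv ν (u j) x := by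
  obtain ⟨n, hn⟩ := exists_mem_ball x
  exact Summable.of_norm_bounded (hu n) fun j => norm_partialDeriv_le_of_mem_ball _ hν hn

theorem continuous_tsum_partialDeriv
    {u : ℕ → Cm d m} (hu : ∀ n, Summable fun j => ballSeminorm d m n (u j))
    {ν : Fin d → ℕ} (hν : ∑ i, ν i ≤ m) :
    Continuous fun x => ∑' j, partialDeriv ν (u j) x := by
  refine continuous_iff_continuousAt.2 fun x => ?_
  obtain ⟨n, hn⟩ := exists_mem_ball x
  exact (continuousOn_tsum (fun j => (continuous_partialDeriv (u j).contDiff ν hν).continuousOn)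
    (hu n) (fun j x hx => norm_partialDeriv_le_of_mem_ball _ hν hx)).continuousAt
    (Metric.isOpen_ball.mem_nhds hn)

theorem hasFDerivAt_tsum_partialDeriv
    {u : ℕ → Cm d m} (hu : ∀ n, Summable fun j => ballSeminorm d m n (u j))
    {ν : Fin d → ℕ} (hν : ∑ i, ν i < m) (x : Euc d) :
    HasFDerivAt (fun x => ∑' j, partialDeriv ν (u j) x)
      (gradCLM fun i => ∑' j, partialDeriv (ν + Pi.single i 1) (u j) x) x := by
  obtain ⟨n, hn⟩ := exists_mem_ball x
  have hν' : ∀ i, ∑ j, (ν + Pi.single i 1 : Fin d → ℕ) j ≤ m := fun i => by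
    rw [sum_add_single]; omega
  have hbound : ∀ (j : ℕ) (y : Euc d), y ∈ Metric.ball (0 : Euc d) n →
      ‖gradCLM fun i => partialDeriv (ν + Pi.single i 1) (u j) y‖ ≤
        d * ballSeminorm d m n (u j) := fun j y hy =>
    (norm_gradCLM_le _).trans ((Finset.sum_le_sum fun i _ =>
      norm_partialDeriv_le_of_mem_ball (u j) (hν' i) hy).trans (by simp))
  rw [gradCLM_tsum fun i => summable_partialDeriv hu (hν' i) x]
  exact hasFDerivAt_tsum_of_isPreconnected ((hu n).mul_left (d : ℝ)) Metric.isOpen_ball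
    (convex_ball (0 : Euc d) (n : ℝ)).isPreconnected
    (fun j y _ => hasFDerivAt_partialDeriv (u j).contDiff ν hν y) hbound
    hn (summable_partialDeriv hu hν.le x) hn

/-- `E^m(ℝ^d)` is complete: absolutely summable series converge. -/
theorem exists_tendsto_of_summable
    {u : ℕ → Cm d m} (hu : ∀ n, Summable fun j => ballSeminorm d m n (u j)) :
    ∃ f : Cm d m, Filter.Tendsto (fun N => ∑ j ∈ Finset.range N, u j) Filter.atTop (nhds f) := by
  have hd := fun (ν : Fin d → ℕ) (hν : ∑ i, ν i < m) => hasFDerivAt_tsum_partialDeriv hu hν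
  have hg := contDiff_of_hasFDerivAt_family (m := m)
    (g := fun ν x => ∑' j, partialDeriv ν (u j) x)
    (fun ν hν => continuous_tsum_partialDeriv hu hν) hd m 0 (by simp)
  obtain ⟨f, hf⟩ : ∃ f : Cm d m, (f : Euc d → ℂ) = fun x => ∑' j, partialDeriv 0 (u j) x :=
    ⟨⟨_, hg⟩, rfl⟩
  refine ⟨f, (tendsto_iff _ _).2 fun n => ?_⟩
  refine squeeze_zero (fun _ => apply_nonneg _ _) (fun N => ?_)
    (tendsto_sum_nat_add fun j => ballSeminorm d m n (u j))
  refine ballSeminorm_le (tsum_nonneg fun _ => apply_nonneg _ _) fun x hx ν hν => ?_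
  have h1 : partialDeriv ν f = fun x => ∑' j, partialDeriv ν (u j) x := by
    rw [hf]
    exact partialDeriv_of_hasFDerivAt_family (g := fun ν x => ∑' j, partialDeriv ν (u j) x) hd ν hν
  have h2 : ∑' j, partialDeriv ν (u j) x - ∑ j ∈ Finset.range N, partialDeriv ν (u j) x =
      ∑' j, partialDeriv ν (u (j + N)) x := by
    rw [sub_eq_iff_eq_add', (summable_partialDeriv hu hν x).sum_add_tsum_nat_add]
  rw [partialDeriv_sub _ _ ν hν, partialDeriv_sum _ _ ν hν, Pi.sub_apply, Finset.sum_apply,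
    h1, norm_sub_rev, h2]
  exact tsum_of_norm_bounded ((summable_nat_add_iff N).2 (hu n)).hasSum
    fun j => norm_le_ballSeminorm (u (j + N)) hx ν hν

end Cm

end

/-! ### The closed graph theorem for maps from a Banach space to a Fréchet space -/

section
open Filter Topology

variable {W E : Type*} [NormedAddCommGroup W] [NormedSpace ℂ W] [AddCommGroup E] [Module ℂ E]

/-- By Baire's theorem, every seminorm on a Banach space is bounded, up to arbitrarily small errors,
by a multiple of the norm. -/
theorem exists_approx_of_seminorm [CompleteSpace W] (p : Seminorm ℂ W) :
    ∃ C : ℝ, 0 < C ∧ ∀ w : W, ∀ ε > 0, ∃ v, ‖w - v‖ < ε ∧ p v ≤ C * ‖w‖ := by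
  obtain ⟨n, x, hx⟩ := nonempty_interior_of_iUnion_of_closed
    (f := fun n : ℕ => closure {w : W | p w ≤ n}) (fun _ => isClosed_closure) (by
      refine Set.eq_univ_of_forall fun w => ?_
      obtain ⟨n, hn⟩ := exists_nat_ge (p w)
      exact Set.mem_iUnion.2 ⟨n, subset_closure hn⟩)
  obtain ⟨r, hr, hball⟩ := Metric.isOpen_iff.1 isOpen_interior x hx
  have happ : ∀ y ∈ Metric.ball x r, ∀ ε > 0, ∃ v, ‖y - v‖ < ε ∧ p v ≤ n := by
    intro y hy ε hε
    obtain ⟨v, hv, hyv⟩ := Metric.mem_closure_iff.1 (interior_subset (hball hy)) ε hε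
    exact ⟨v, by rwa [← dist_eq_norm], hv⟩
  have h0 : ∀ w : W, ‖w‖ < r → ∀ ε > 0, ∃ v, ‖w - v‖ < ε ∧ p v ≤ 2 * n := by
    intro w hw ε hε
    obtain ⟨v₁, h1, h1'⟩ := happ (x + w) (by simpa using hw) (ε / 2) (half_pos hε)
    obtain ⟨v₂, h2, h2'⟩ := happ x (Metric.mem_ball_self hr) (ε / 2) (half_pos hε)
    refine ⟨v₁ - v₂, ?_, (map_sub_le_add p _ _).trans (by linarith)⟩
    have : w - (v₁ - v₂) = (x + w - v₁) - (x - v₂) := by abel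
    rw [this]
    exact (norm_sub_le _ _).trans_lt (by linarith)
  refine ⟨4 * n / r + 1, by positivity, fun w ε hε => ?_⟩
  rcases eq_or_ne w 0 with rfl | hw
  · exact ⟨0, by simpa using hε, by simp⟩
  have hw0 : 0 < ‖w‖ := norm_pos_iff.2 hw
  -- the factor `c` moves `w` into the ball of radius `r`
  set c : ℝ := r / (2 * ‖w‖) with hc
  have hc0 : 0 < c := by positivity
  have hcw : c * ‖w‖ = r / 2 := by rw [hc]; field_simp
  obtain ⟨v, hv, hpv⟩ := h0 ((c : ℂ) • w)
    (by rw [norm_smul, Complex.norm_real, Real.norm_of_nonneg hc0.le, hcw]; linarith)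
    (c * ε) (by positivity)
  have hcc : (c : ℂ) ≠ 0 := by exact_mod_cast hc0.ne'
  have hcn : ‖(c : ℂ)⁻¹‖ = c⁻¹ := by
    rw [norm_inv, Complex.norm_real, Real.norm_of_nonneg hc0.le]
  refine ⟨(c : ℂ)⁻¹ • v, ?_, ?_⟩
  · have : w - (c : ℂ)⁻¹ • v = (c : ℂ)⁻¹ • ((c : ℂ) • w - v) := by
      rw [smul_sub, inv_smul_smul₀ hcc]
    rw [this, norm_smul, hcn, inv_mul_lt_iff₀ hc0]
    exact hv
  · rw [map_smul_eq_mul, hcn, inv_mul_le_iff₀ hc0]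
    refine hpv.trans ?_
    have : c * ((4 * n / r + 1) * ‖w‖) = (4 * n / r + 1) * (r / 2) := by rw [← hcw]; ring
    rw [this]
    have : (4 * n / r + 1) * (r / 2) = 2 * n + r / 2 := by field_simp; ring
    linarith

/-- The closed graph theorem for a linear map from a Banach space to a space that is complete with
respect to an increasing sequence of seminorms. -/
theorem bound_of_seq_closed_graph [CompleteSpace W] (q : ℕ → Seminorm ℂ E) (hq : Monotone q)
    (hcomplete : ∀ u : ℕ → E, (∀ k, Summable fun j => q k (u j)) →
      ∃ f, ∀ k, Tendsto (fun N => q k (∑ j ∈ Finset.range N, u j - f)) atTop (𝓝 0))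
    (S : W →ₗ[ℂ] E)
    (hclosed : ∀ (w : ℕ → W) (w₀ : W) (y : E), Tendsto w atTop (𝓝 w₀) →
      (∀ k, Tendsto (fun N => q k (S (w N) - y)) atTop (𝓝 0)) → S w₀ = y) (k : ℕ) :
    ∃ C : ℝ, ∀ w, q k (S w) ≤ C * ‖w‖ := by
  choose C hC happ using fun j => exists_approx_of_seminorm ((q (k + j)).comp S)
  choose! v hv hpv using happ
  refine ⟨(C 0 + 1) * 2, fun w => ?_⟩
  rcases eq_or_ne w 0 with rfl | hw
  · simp
  have hw0 : 0 < ‖w‖ := norm_pos_iff.2 hw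
  -- successive approximation: `r j` is the part of `w` that remains after `j` steps
  set e : ℕ → ℝ := fun j => ‖w‖ * (1 / 2) ^ j / (1 + C j) with he
  have he0 : ∀ j, 0 < e j := fun j => by have := hC j; positivity
  let r : ℕ → W := fun j => Nat.rec w (fun j x => x - v j x (e (j + 1))) j
  have hr : ∀ j, r (j + 1) = r j - v j (r j) (e (j + 1)) := fun j => rfl
  set u : ℕ → W := fun j => v j (r j) (e (j + 1)) with hu
  have hsum : ∀ N, ∑ j ∈ Finset.range N, u j = w - r N := by
    intro N
    induction N with
    | zero => simp [r]
    | succ N ih => rw [Finset.sum_range_succ, ih, hr, ← sub_add]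
  have hrn : ∀ j, ‖r (j + 1)‖ ≤ e (j + 1) := fun j => by
    rw [hr]; exact (hv j _ _ (he0 _)).le
  have hrn' : ∀ j, ‖r j‖ ≤ ‖w‖ * (1 / 2) ^ j := by
    intro j
    cases j with
    | zero => simp [r]
    | succ j =>
      refine (hrn j).trans (div_le_self (by positivity) ?_)
      linarith [hC (j + 1)]
  have hq1 : ∀ j, q (k + j) (S (u j)) ≤ (C 0 + 1) * (‖w‖ * (1 / 2) ^ j) := by
    intro j
    refine (hpv j (r j) (e (j + 1)) (he0 _)).trans ?_
    cases j with
    | zero => simp only [r]; simp; nlinarith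
    | succ j =>
      have h1 : C (j + 1) * ‖r (j + 1)‖ ≤ ‖w‖ * (1 / 2) ^ (j + 1) := by
        refine (mul_le_mul_of_nonneg_left (hrn j) (hC _).le).trans ?_
        rw [he, mul_div_assoc']
        have := hC (j + 1)
        rw [div_le_iff₀ (by positivity), mul_comm]
        gcongr
        linarith
      refine h1.trans (le_mul_of_one_le_left (by positivity) ?_)
      linarith [hC 0]
  have hgeo : HasSum (fun j : ℕ => (C 0 + 1) * (‖w‖ * (1 / 2) ^ j)) ((C 0 + 1) * (‖w‖ * 2)) :=
    (hasSum_geometric_two.mul_left _).mul_left _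
  have hsumm : ∀ l, Summable fun j => q l (S (u j)) := by
    intro l
    rw [← summable_nat_add_iff l]
    refine Summable.of_nonneg_of_le (fun _ => apply_nonneg _ _) (fun j => ?_)
      ((summable_nat_add_iff l).2 hgeo.summable)
    exact (hq (by omega : l ≤ k + (j + l)) _).trans (hq1 (j + l))
  obtain ⟨f, hf⟩ := hcomplete (fun j => S (u j)) hsumm
  have hr0 : Tendsto r atTop (𝓝 0) := by
    refine squeeze_zero_norm hrn' ?_
    simpa using (tendsto_pow_atTop_nhds_zero_of_lt_one (by norm_num : (0 : ℝ) ≤ 1 / 2)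
      (by norm_num)).const_mul ‖w‖
  have hwf : S w = f := by
    refine hclosed (fun N => ∑ j ∈ Finset.range N, u j) w f ?_ fun l => ?_
    · simp only [hsum]
      simpa using hr0.const_sub w
    · simpa only [map_sum] using hf l
  rw [hwf]
  have hle : ∀ N, q k f ≤ q k (∑ j ∈ Finset.range N, S (u j) - f) + (C 0 + 1) * (‖w‖ * 2) := by
    intro N
    have h1 : q k f ≤ q k (∑ j ∈ Finset.range N, S (u j) - f) +
        q k (∑ j ∈ Finset.range N, S (u j)) := by
      have := map_sub_le_add (q k) (∑ j ∈ Finset.range N, S (u j))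
        (∑ j ∈ Finset.range N, S (u j) - f)
      rw [sub_sub_cancel] at this
      linarith
    have h2 : q k (∑ j ∈ Finset.range N, S (u j)) ≤ ∑ j ∈ Finset.range N, q k (S (u j)) :=
      Finset.le_sum_of_subadditive (q k) (map_zero (q k)).le (map_add_le_add _) _ _
    have h3 : ∑ j ∈ Finset.range N, q k (S (u j)) ≤
        ∑ j ∈ Finset.range N, (C 0 + 1) * (‖w‖ * (1 / 2) ^ j) :=
      Finset.sum_le_sum fun j _ => (hq (by omega : k ≤ k + j) _).trans (hq1 j)
    have h4 := hgeo.summable.sum_le_tsum (Finset.range N)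
      (fun j _ => by have := hC 0; positivity)
    rw [hgeo.tsum_eq] at h4
    linarith
  have := ge_of_tendsto' ((hf k).add_const ((C 0 + 1) * (‖w‖ * 2))) hle
  rw [zero_add] at this
  linarith

end

/-! ### Smooth lattice partitions of unity -/

section
open Filter Topology
variable {d : ℕ}

theorem sum_Ico_int_telescope (F : ℤ → ℝ) {a b : ℤ} (h : a ≤ b) :
    ∑ z ∈ Finset.Ico a b, (F z - F (z + 1)) = F a - F b := by
  induction b, h using Int.leInduction with
  | base => simp
  | succ b hb ih =>
    have : Finset.Ico a (b + 1) = insert b (Finset.Ico a b) := by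
      ext z; simp only [Finset.mem_Ico, Finset.mem_insert]; omega
    rw [this, Finset.sum_insert (by simp), ih]
    ring

/-- A smooth function on `ℝ` with support in `[-1, 1]` whose integer translates sum to `1`. -/
def bumpOne (t : ℝ) : ℝ := Real.smoothTransition (t + 1) - Real.smoothTransition t

theorem contDiff_bumpOne {n : ℕ} : ContDiff ℝ n bumpOne := by
  have h : ContDiff ℝ n Real.smoothTransition := Real.smoothTransition.contDiff (n := n)
  exact (h.comp (contDiff_id.add contDiff_const)).sub h

theorem bumpOne_eq_zero {t : ℝ} (h : 1 < |t|) : bumpOne t = 0 := by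
  rcases lt_abs.1 h with h | h
  · rw [bumpOne, Real.smoothTransition.one_of_one_le (by linarith),
      Real.smoothTransition.one_of_one_le (by linarith), sub_self]
  · rw [bumpOne, Real.smoothTransition.zero_of_nonpos (by linarith),
      Real.smoothTransition.zero_of_nonpos (by linarith), sub_self]

theorem sum_bumpOne {t : ℝ} {a b : ℤ} (ha : (a : ℝ) ≤ t) (hb : t + 1 ≤ b) :
    ∑ z ∈ Finset.Ico a b, bumpOne (t - z) = 1 := by
  have hab : a ≤ b := by exact_mod_cast (by linarith : (a : ℝ) ≤ b)
  have h := sum_Ico_int_telescope (fun z : ℤ => Real.smoothTransition (t - z + 1)) hab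
  rw [Real.smoothTransition.one_of_one_le (by linarith),
    Real.smoothTransition.zero_of_nonpos (by linarith), sub_zero] at h
  rw [← h]
  refine Finset.sum_congr rfl fun z _ => ?_
  rw [bumpOne]
  push_cast
  ring_nf

theorem norm_le_of_coord {x : Euc d} {c : ℝ} (h : ∀ i, |x i| ≤ c) : ‖x‖ ≤ d * c := by
  have hx : x = ∑ i, x i • (EuclideanSpace.single i 1 : Euc d) := by
    ext k; simp [Pi.single_apply]
  have hsum : ∑ i, ‖x i • (EuclideanSpace.single i 1 : Euc d)‖ ≤ ∑ _i : Fin d, c :=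
    Finset.sum_le_sum fun i _ => by simpa [norm_smul] using h i
  rw [hx]
  exact (norm_sum_le _ _).trans (hsum.trans_eq (by simp))

/-- The product of the functions `bumpOne` in all coordinates. -/
def bump (x : Euc d) : ℝ := ∏ i, bumpOne (x i)

theorem contDiff_bump {n : ℕ} : ContDiff ℝ n (bump : Euc d → ℝ) :=
  contDiff_prod fun i _ => contDiff_bumpOne.comp (EuclideanSpace.proj (𝕜 := ℝ) i).contDiff

theorem bump_eq_zero {x : Euc d} {i : Fin d} (h : 1 < |x i|) : bump x = 0 :=
  Finset.prod_eq_zero (Finset.mem_univ i) (bumpOne_eq_zero h)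

theorem exists_bound_bump (d j : ℕ) :
    ∃ P : ℝ, 0 ≤ P ∧ ∀ x : Euc d, ‖iteratedFDeriv ℝ j bump x‖ ≤ P := by
  have hs : HasCompactSupport (bump : Euc d → ℝ) := by
    refine HasCompactSupport.intro (isCompact_closedBall (0 : Euc d) (d * 1)) fun x hx => ?_
    by_contra h
    exact hx (mem_closedBall_zero_iff.2 (norm_le_of_coord fun i =>
      not_lt.1 fun hi => h (bump_eq_zero hi)))
  obtain ⟨P, hP⟩ := Continuous.bounded_above_of_compact_support
    ((contDiff_bump (d := d) (n := j)).continuous_iteratedFDeriv') (hs.iteratedFDeriv j)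
  exact ⟨P, (norm_nonneg _).trans (hP 0), hP⟩

/-- The point of `ℤ^d ⊆ ℝ^d` with coordinates `z`. -/
def latticePt (z : Fin d → ℤ) : Euc d := WithLp.toLp 2 fun i => (z i : ℝ)

theorem latticePt_apply (z : Fin d → ℤ) (i : Fin d) : latticePt z i = z i := rfl

/-- The translate of `bump` to the point `s⁻¹ z` of the lattice `s⁻¹ ℤ^d`, at the scale `s⁻¹`. -/
def latticeBump (s : ℝ) (z : Fin d → ℤ) (x : Euc d) : ℝ := bump (s • x - latticePt z)

theorem contDiff_latticeBump {n : ℕ} (s : ℝ) (z : Fin d → ℤ) :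
    ContDiff ℝ n (latticeBump s z) :=
  contDiff_bump.comp ((contDiff_const_smul s).sub contDiff_const)

theorem norm_iteratedFDeriv_latticeBump_le {s : ℝ} (hs : 0 ≤ s) (z : Fin d → ℤ) {j : ℕ} {P : ℝ}
    (hP : ∀ x : Euc d, ‖iteratedFDeriv ℝ j bump x‖ ≤ P) (x : Euc d) :
    ‖iteratedFDeriv ℝ j (latticeBump s z) x‖ ≤ s ^ j * P := by
  have h1 : ContDiff ℝ j fun x : Euc d => bump (x - latticePt z) :=
    contDiff_bump.comp (contDiff_id.sub contDiff_const)
  have h2 := congrFun (iteratedFDeriv_comp_const_smul s h1) x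
  have h3 : (fun x => bump (s • x - latticePt z)) = latticeBump s z := rfl
  rw [← h3, h2, norm_smul, iteratedFDeriv_comp_sub, norm_pow, Real.norm_of_nonneg hs]
  gcongr
  exact hP _

/-- If `latticeBump s z` does not vanish at `x`, then `x` is close to `s⁻¹ z`. -/
theorem dist_le_of_latticeBump_ne_zero {s : ℝ} (hs : 0 < s) {z : Fin d → ℤ} {x : Euc d}
    (h : latticeBump s z x ≠ 0) : dist x (s⁻¹ • latticePt z) ≤ d / s := by
  have h1 : ‖s • x - latticePt z‖ ≤ d * 1 :=
    norm_le_of_coord fun i => not_lt.1 fun hi => h (bump_eq_zero hi)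
  have h2 : x - s⁻¹ • latticePt z = s⁻¹ • (s • x - latticePt z) := by
    rw [smul_sub, inv_smul_smul₀ hs.ne']
  rw [dist_eq_norm, h2, norm_smul, norm_inv, Real.norm_of_nonneg hs.le, inv_mul_le_iff₀ hs,
    mul_div_cancel₀ _ hs.ne']
  linarith

/-- A finite set of lattice points that contains all `z` for which `bump (y - z)` is not `0` for some
`y` near `x`. -/
def box (x : Euc d) : Finset (Fin d → ℤ) :=
  Fintype.piFinset fun i => Finset.Ico (⌊x i⌋ - 2) (⌊x i⌋ + 4)

theorem card_box (x : Euc d) : (box x).card = 6 ^ d := by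
  have : ∀ i, ⌊x i⌋ + 4 - (⌊x i⌋ - 2) = 6 := fun i => by ring
  simp [box, this]

theorem mem_box {x : Euc d} {z : Fin d → ℤ} :
    z ∈ box x ↔ ∀ i, ⌊x i⌋ - 2 ≤ z i ∧ z i < ⌊x i⌋ + 4 := by
  simp [box]

theorem dist_le_of_mem_box {s : ℝ} (hs : 0 < s) {x : Euc d} {z : Fin d → ℤ}
    (hz : z ∈ box (s • x)) : dist x (s⁻¹ • latticePt z) ≤ 4 * d / s := by
  have h1 : ‖s • x - latticePt z‖ ≤ d * 4 := by
    refine norm_le_of_coord fun i => ?_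
    obtain ⟨h1, h2⟩ := mem_box.1 hz i
    have h3 := Int.floor_le ((s • x) i)
    have h4 := Int.lt_floor_add_one ((s • x) i)
    have h5 : ((⌊(s • x) i⌋ : ℝ) - 2) ≤ z i := by exact_mod_cast h1
    have h6 : (z i : ℝ) + 1 ≤ ⌊(s • x) i⌋ + 4 := by exact_mod_cast h2
    rw [PiLp.sub_apply, latticePt_apply, abs_le]
    constructor <;> linarith
  have h2 : x - s⁻¹ • latticePt z = s⁻¹ • (s • x - latticePt z) := by
    rw [smul_sub, inv_smul_smul₀ hs.ne']
  rw [dist_eq_norm, h2, norm_smul, norm_inv, Real.norm_of_nonneg hs.le, inv_mul_le_iff₀ hs,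
    mul_div_cancel₀ _ hs.ne']
  linarith

/-- Near `x` only the lattice points in `box (s • x)` contribute, and their bumps sum to `1`. -/
theorem eventually_latticeBump (s : ℝ) (x : Euc d) :
    ∀ᶠ y in 𝓝 x, (∀ z ∉ box (s • x), latticeBump s z y = 0) ∧
      ∑ z ∈ box (s • x), latticeBump s z y = 1 := by
  have h : ∀ᶠ y in 𝓝 x, ∀ i, |(s • y) i - (s • x) i| < 1 := by
    refine eventually_all.2 fun i => ?_
    have hc : Continuous fun y : Euc d => |(s • y) i - (s • x) i| := by fun_prop
    refine hc.continuousAt.eventually (gt_mem_nhds ?_)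
    simp
  filter_upwards [h] with y hy
  have hb : ∀ i, (⌊(s • x) i⌋ : ℝ) - 1 < (s • y) i ∧ (s • y) i < ⌊(s • x) i⌋ + 2 := fun i => by
    have h1 := abs_lt.1 (hy i)
    have h3 := Int.floor_le ((s • x) i)
    have h4 := Int.lt_floor_add_one ((s • x) i)
    constructor <;> linarith
  constructor
  · intro z hz
    rw [mem_box, not_forall] at hz
    obtain ⟨i, hi⟩ := hz
    refine bump_eq_zero (i := i) ?_
    rw [PiLp.sub_apply, latticePt_apply, lt_abs]
    rw [not_and_or, not_le, not_lt] at hi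
    rcases hi with hi | hi
    · left
      have : (z i : ℝ) + 1 ≤ ⌊(s • x) i⌋ - 2 := by exact_mod_cast hi
      linarith [(hb i).1]
    · right
      have : (⌊(s • x) i⌋ : ℝ) + 4 ≤ z i := by exact_mod_cast hi
      linarith [(hb i).2]
  · have : ∀ z, latticeBump s z y = ∏ i, bumpOne ((s • y) i - z i) := fun z => rfl
    simp only [this]
    rw [box, ← Finset.prod_univ_sum _ fun (i : Fin d) (w : ℤ) => bumpOne ((s • y) i - w)]
    refine Finset.prod_eq_one fun i _ => sum_bumpOne ?_ ?_
    · push_cast; linarith [(hb i).1]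
    · push_cast; linarith [(hb i).2]

/-! ### Smooth cutoffs around a set, and the Whitney partition of unity -/

open Classical in
/-- The sum of the bumps at scale `s⁻¹` whose centres have distance at most `2 (d + 1) / s` from
`X`: a smooth function that is `1` near `X` and `0` far away from `X`, at the scale `s⁻¹`. -/
def cutoff (X : Set (Euc d)) (s : ℝ) (x : Euc d) : ℝ :=
  ∑ᶠ z : Fin d → ℤ, if Metric.infDist (s⁻¹ • latticePt z) X ≤ 2 * (d + 1) / s then
    latticeBump s z x else 0

open Classical in
theorem eventually_cutoff_eq (X : Set (Euc d)) (s : ℝ) (x : Euc d) :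
    cutoff X s =ᶠ[𝓝 x] fun y => ∑ z ∈ box (s • x),
      if Metric.infDist (s⁻¹ • latticePt z) X ≤ 2 * (d + 1) / s then latticeBump s z y else 0 := by
  filter_upwards [eventually_latticeBump s x] with y hy
  refine finsum_eq_sum_of_support_subset _ fun z hz => ?_
  by_contra h
  refine hz ?_
  simp [hy.1 z (by simpa using h)]

theorem contDiff_cutoff {n : ℕ} (X : Set (Euc d)) (s : ℝ) : ContDiff ℝ n (cutoff X s) := by
  classical
  refine contDiff_iff_contDiffAt.2 fun x => ?_
  refine ContDiffAt.congr_of_eventuallyEq (ContDiff.contDiffAt ?_) (eventually_cutoff_eq X s x)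
  refine ContDiff.sum fun z _ => ?_
  split_ifs
  · exact contDiff_latticeBump s z
  · exact contDiff_const

theorem norm_iteratedFDeriv_cutoff_le (X : Set (Euc d)) {s : ℝ} (hs : 0 ≤ s) {j : ℕ} {P : ℝ}
    (hP0 : 0 ≤ P) (hP : ∀ x : Euc d, ‖iteratedFDeriv ℝ j bump x‖ ≤ P) (x : Euc d) :
    ‖iteratedFDeriv ℝ j (cutoff X s) x‖ ≤ 6 ^ d * (s ^ j * P) := by
  classical
  rw [Filter.EventuallyEq.eq_of_nhds ((eventually_cutoff_eq X s x).iteratedFDeriv ℝ j),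
    iteratedFDeriv_fun_sum_apply]
  · refine (norm_sum_le_of_le _ (fun z _ => ?_ : ∀ z ∈ box (s • x), _ ≤ s ^ j * P)).trans ?_
    · split_ifs
      · exact norm_iteratedFDeriv_latticeBump_le hs z hP x
      · rw [iteratedFDeriv_fun_zero, Pi.zero_apply, norm_zero]
        positivity
    · simp [card_box]
  · intro z _
    split_ifs
    · exact (contDiff_latticeBump s z).contDiffAt
    · exact contDiffAt_const

theorem cutoff_eq_one (X : Set (Euc d)) {s : ℝ} (hs : 0 < s) {x : Euc d}
    (h : s * Metric.infDist x X ≤ d + 1) : cutoff X s x = 1 := by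
  classical
  rw [(eventually_cutoff_eq X s x).self_of_nhds]
  refine Eq.trans ?_ (eventually_latticeBump s x).self_of_nhds.2
  refine Finset.sum_congr rfl fun z _ => ?_
  by_cases hz : latticeBump s z x = 0
  · simp [hz]
  · rw [if_pos]
    have h1 := dist_le_of_latticeBump_ne_zero hs hz
    have h2 := Metric.infDist_le_infDist_add_dist (s := X) (x := s⁻¹ • latticePt z) (y := x)
    rw [dist_comm] at h2
    refine h2.trans ((add_le_add_right h1 _).trans ?_)
    rw [le_div_iff₀ hs, add_mul, div_mul_cancel₀ _ hs.ne']
    linarith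

theorem cutoff_eq_zero (X : Set (Euc d)) {s : ℝ} (hs : 0 < s) {x : Euc d}
    (h : 3 * (d + 1) < s * Metric.infDist x X) : cutoff X s x = 0 := by
  classical
  rw [(eventually_cutoff_eq X s x).self_of_nhds]
  refine Finset.sum_eq_zero fun z _ => ?_
  by_cases hz : latticeBump s z x = 0
  · simp [hz]
  · rw [if_neg]
    rw [not_le, div_lt_iff₀ hs]
    have h1 := dist_le_of_latticeBump_ne_zero hs hz
    have h2 := Metric.infDist_le_infDist_add_dist (s := X) (x := x) (y := s⁻¹ • latticePt z)
    have h3 := mul_le_mul_of_nonneg_left (h2.trans (add_le_add_right h1 _)) hs.le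
    rw [mul_add, mul_div_cancel₀ _ hs.ne'] at h3
    linarith

/-- The members of the Whitney partition of unity: `latticeBump` at the scale `2⁻ⁿ`, cut off to the
points whose distance from `X` is comparable to `2⁻ⁿ`. -/
def whitneyBump (X : Set (Euc d)) (p : Σ _ : ℤ, Fin d → ℤ) (x : Euc d) : ℝ :=
  (cutoff X (2 ^ p.1) x - cutoff X (2 ^ (p.1 + 1)) x) • latticeBump (2 ^ p.1) p.2 x

theorem contDiff_whitneyBump {n : ℕ} (X : Set (Euc d)) (p : Σ _ : ℤ, Fin d → ℤ) :
    ContDiff ℝ n (whitneyBump X p) :=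
  ((contDiff_cutoff X _).sub (contDiff_cutoff X _)).smul (contDiff_latticeBump _ _)

theorem exists_bound_whitneyBump (X : Set (Euc d)) (j : ℕ) :
    ∃ R : ℝ, 0 ≤ R ∧ ∀ p x, ‖iteratedFDeriv ℝ j (whitneyBump X p) x‖ ≤ ((2 : ℝ) ^ p.1) ^ j * R := by
  choose P hP0 hP using exists_bound_bump d
  refine ⟨∑ i ∈ Finset.range (j + 1), (j.choose i : ℝ) * (6 ^ d * ((1 + 2 ^ i) * P i)) * P (j - i),
    Finset.sum_nonneg fun i _ => by have := hP0 i; have := hP0 (j - i); positivity, fun p x => ?_⟩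
  have h0 : (0 : ℝ) < 2 ^ p.1 := by positivity
  have h1 : (2 : ℝ) ^ (p.1 + 1) = 2 * 2 ^ p.1 := by rw [zpow_add_one₀ two_ne_zero, mul_comm]
  refine (norm_iteratedFDeriv_smul_le (N := j) ((contDiff_cutoff X _).sub (contDiff_cutoff X _))
    (contDiff_latticeBump _ _) x le_rfl).trans ?_
  rw [Finset.mul_sum]
  refine Finset.sum_le_sum fun i hi => ?_
  have hij : i ≤ j := Nat.lt_succ_iff.1 (Finset.mem_range.1 hi)
  have h2 : ‖iteratedFDeriv ℝ i (fun y => cutoff X (2 ^ p.1) y - cutoff X (2 ^ (p.1 + 1)) y) x‖ ≤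
      ((2 : ℝ) ^ p.1) ^ i * (6 ^ d * ((1 + 2 ^ i) * P i)) := by
    have h3 : (fun y => cutoff X (2 ^ p.1) y - cutoff X (2 ^ (p.1 + 1)) y) =
      cutoff X (2 ^ p.1) - cutoff X (2 ^ (p.1 + 1)) := rfl
    rw [h3, iteratedFDeriv_sub_apply (contDiff_cutoff X _).contDiffAt
      (contDiff_cutoff X _).contDiffAt]
    refine (norm_sub_le _ _).trans ((add_le_add
      (norm_iteratedFDeriv_cutoff_le X h0.le (hP0 i) (hP i) x)
      (norm_iteratedFDeriv_cutoff_le X (h1 ▸ by positivity) (hP0 i) (hP i) x)).trans_eq ?_)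
    rw [h1, mul_pow]
    ring
  have h4 := norm_iteratedFDeriv_latticeBump_le h0.le p.2 (hP (j - i)) x
  have h5 : ((2 : ℝ) ^ p.1) ^ j = ((2 : ℝ) ^ p.1) ^ i * ((2 : ℝ) ^ p.1) ^ (j - i) := by
    rw [← pow_add, Nat.add_sub_cancel' hij]
  have := hP0 i
  calc _ ≤ (j.choose i : ℝ) * (((2 : ℝ) ^ p.1) ^ i * (6 ^ d * ((1 + 2 ^ i) * P i))) *
        (((2 : ℝ) ^ p.1) ^ (j - i) * P (j - i)) := by gcongr
    _ = _ := by rw [h5]; ring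

/-- The Whitney partition of unity on the complement of a nonempty closed set `X`. At a point `x`
only the scales `2⁻ⁿ` comparable to the distance from `x` to `X` matter, as both cutoffs in
`whitneyBump` are `1` at larger scales and `0` at smaller ones; so the sum over the scales
telescopes to `1`. -/
theorem exists_whitney_partition {X : Set (Euc d)} (hX : IsClosed X) (hne : X.Nonempty) :
    ∃ (ι : Type) (θ : ι → Euc d → ℝ) (a : ι → X) (N : ℕ) (C : ℕ → ℝ),
      (∀ i (n : ℕ), ContDiff ℝ n (θ i)) ∧ (∀ j, 0 ≤ C j) ∧
      ∀ x ∉ X, ∃ B : Finset ι, B.card ≤ N ∧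
        (∀ᶠ y in 𝓝 x, (∀ i ∉ B, θ i y = 0) ∧ ∑ i ∈ B, θ i y = 1) ∧
        ∀ i ∈ B, dist x (a i) ≤ 65 * Metric.infDist x X ∧
          ∀ j, ‖iteratedFDeriv ℝ j (θ i) x‖ * Metric.infDist x X ^ j ≤ C j := by
  choose R hR0 hR using exists_bound_whitneyBump X
  have hnear : ∀ p : Σ _ : ℤ, Fin d → ℤ, ∃ a : X,
      Metric.infDist (((2 : ℝ) ^ p.1)⁻¹ • latticePt p.2) X =
        dist (((2 : ℝ) ^ p.1)⁻¹ • latticePt p.2) a := fun p => by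
    obtain ⟨a, ha, h⟩ := hX.exists_infDist_eq_dist hne (((2 : ℝ) ^ p.1)⁻¹ • latticePt p.2)
    exact ⟨⟨a, ha⟩, h⟩
  choose a ha using hnear
  refine ⟨_, whitneyBump X, a, 7 * 6 ^ d, fun j => (32 * (d + 1)) ^ j * R j,
    fun p n => contDiff_whitneyBump X p, fun j => by have := hR0 j; positivity, fun x hx => ?_⟩
  set δ := Metric.infDist x X with hδ
  have hδ0 : 0 < δ := (hX.notMem_iff_infDist_pos hne).1 hx
  have hd0 : (0 : ℝ) < d + 1 := by positivity
  -- the scale `2^(-n₀)` is comparable to the distance `δ` from `x` to `X`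
  obtain ⟨n₀, hn1, hn2⟩ := exists_mem_Ico_zpow (div_pos hd0 hδ0) (one_lt_two (α := ℝ))
  rw [le_div_iff₀ hδ0] at hn1
  rw [div_lt_iff₀ hδ0] at hn2
  have hsmall : ∀ y, Metric.infDist y X < 2 * δ → ∀ n ≤ n₀ - 1, cutoff X (2 ^ n) y = 1 := by
    intro y hy n hn
    refine cutoff_eq_one X (by positivity) ?_
    have h1 : (2 : ℝ) ^ n ≤ 2 ^ (n₀ - 1) := zpow_le_zpow_right₀ one_le_two hn
    have h2 : (2 : ℝ) ^ (n₀ - 1) * 2 = 2 ^ n₀ := by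
      rw [← zpow_add_one₀ two_ne_zero, sub_add_cancel]
    calc (2 : ℝ) ^ n * Metric.infDist y X ≤ 2 ^ (n₀ - 1) * (2 * δ) := by
          have := Metric.infDist_nonneg (x := y) (s := X)
          gcongr
      _ = 2 ^ n₀ * δ := by rw [← h2]; ring
      _ ≤ d + 1 := hn1
  have hlarge : ∀ y, δ / 2 < Metric.infDist y X → ∀ n ≥ n₀ + 5, cutoff X (2 ^ n) y = 0 := by
    intro y hy n hn
    refine cutoff_eq_zero X (by positivity) ?_
    have h1 : (2 : ℝ) ^ (n₀ + 5) ≤ 2 ^ n := zpow_le_zpow_right₀ one_le_two hn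
    have h2 : (2 : ℝ) ^ (n₀ + 5) = 2 ^ (n₀ + 1) * 16 := by
      rw [show n₀ + 5 = (n₀ + 1) + 4 by ring, zpow_add₀ two_ne_zero]; norm_num
    have h3 : (2 : ℝ) ^ (n₀ + 5) * (δ / 2) ≤ 2 ^ n * Metric.infDist y X := by gcongr
    rw [h2] at h3
    linarith
  have hscale : ∀ n ∈ Finset.Ico (n₀ - 2) (n₀ + 5), (2 : ℝ) ^ n * δ ≤ 32 * (d + 1) ∧
      (d + 1) / (2 : ℝ) ^ n ≤ 8 * δ := by
    intro n hn
    obtain ⟨h1, h2⟩ := Finset.mem_Ico.1 hn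
    have h3 : (2 : ℝ) ^ n ≤ 2 ^ (n₀ + 5) := zpow_le_zpow_right₀ one_le_two h2.le
    have h4 : (2 : ℝ) ^ (n₀ - 2) ≤ 2 ^ n := zpow_le_zpow_right₀ one_le_two h1
    have h5 : (2 : ℝ) ^ (n₀ + 5) = 2 ^ n₀ * 32 := by
      rw [zpow_add₀ two_ne_zero]; norm_num
    have h6 : (2 : ℝ) ^ (n₀ + 1) = 2 ^ (n₀ - 2) * 8 := by
      rw [show n₀ + 1 = (n₀ - 2) + 3 by ring, zpow_add₀ two_ne_zero]; norm_num
    refine ⟨?_, ?_⟩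
    · have : (2 : ℝ) ^ n * δ ≤ 2 ^ (n₀ + 5) * δ := by gcongr
      rw [h5] at this
      linarith
    · rw [div_le_iff₀ (by positivity)]
      have : (2 : ℝ) ^ (n₀ - 2) * δ ≤ 2 ^ n * δ := by gcongr
      rw [h6] at hn2
      linarith
  refine ⟨(Finset.Ico (n₀ - 2) (n₀ + 5)).sigma fun n => box ((2 : ℝ) ^ n • x), ?_, ?_, ?_⟩
  · rw [Finset.card_sigma]
    have : n₀ + 5 - (n₀ - 2) = 7 := by ring
    simp [card_box, this]
  · have hc : Continuous fun y => Metric.infDist y X := Metric.continuous_infDist_pt X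
    have h1 : ∀ᶠ y in 𝓝 x, Metric.infDist y X < 2 * δ :=
      hc.continuousAt.eventually (gt_mem_nhds (by linarith))
    have h2 : ∀ᶠ y in 𝓝 x, δ / 2 < Metric.infDist y X :=
      hc.continuousAt.eventually (lt_mem_nhds (by linarith))
    have h3 : ∀ᶠ y in 𝓝 x, ∀ n ∈ Finset.Ico (n₀ - 2) (n₀ + 5),
        (∀ z ∉ box ((2 : ℝ) ^ n • x), latticeBump (2 ^ n) z y = 0) ∧
          ∑ z ∈ box ((2 : ℝ) ^ n • x), latticeBump (2 ^ n) z y = 1 :=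
      (Filter.eventually_all_finset _).2 fun n _ => eventually_latticeBump _ x
    filter_upwards [h1, h2, h3] with y hy1 hy2 hy3
    constructor
    · rintro ⟨n, z⟩ hp
      rw [Finset.mem_sigma, not_and_or] at hp
      by_cases hn : n ∈ Finset.Ico (n₀ - 2) (n₀ + 5)
      · have := (hy3 n hn).1 z (hp.resolve_left (not_not.2 hn))
        simp [whitneyBump, this]
      · rw [Finset.mem_Ico, not_and_or, not_le, not_lt] at hn
        rcases hn with hn | hn
        · simp [whitneyBump, hsmall y hy1 n (by omega), hsmall y hy1 (n + 1) (by omega)]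
        · simp [whitneyBump, hlarge y hy2 n hn, hlarge y hy2 (n + 1) (by omega)]
    · rw [Finset.sum_sigma]
      have h4 : ∀ n ∈ Finset.Ico (n₀ - 2) (n₀ + 5),
          ∑ z ∈ box ((2 : ℝ) ^ n • x), whitneyBump X ⟨n, z⟩ y =
            cutoff X (2 ^ n) y - cutoff X (2 ^ (n + 1)) y := by
        intro n hn
        simp only [whitneyBump]
        rw [← Finset.smul_sum, (hy3 n hn).2, smul_eq_mul, mul_one]
      rw [Finset.sum_congr rfl h4,
        sum_Ico_int_telescope (fun n => cutoff X (2 ^ n) y) (by omega),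
        hsmall y hy1 _ (by omega), hlarge y hy2 _ le_rfl, sub_zero]
  · rintro ⟨n, z⟩ hp
    obtain ⟨hn, hz⟩ := Finset.mem_sigma.1 hp
    obtain ⟨h1, h2⟩ := hscale n hn
    have h0 : (0 : ℝ) < 2 ^ n := by positivity
    refine ⟨?_, fun j => ?_⟩
    · have h3 := dist_le_of_mem_box h0 hz
      have h4 := ha ⟨n, z⟩
      have h5 := Metric.infDist_le_infDist_add_dist (s := X)
        (x := ((2 : ℝ) ^ n)⁻¹ • latticePt z) (y := x)
      have h6 := dist_triangle x (((2 : ℝ) ^ n)⁻¹ • latticePt z) (a ⟨n, z⟩)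
      rw [dist_comm] at h5
      have h7 : 4 * d / (2 : ℝ) ^ n ≤ 4 * ((d + 1) / 2 ^ n) := by
        rw [mul_div_assoc]; gcongr; linarith
      simp only at h4
      linarith
    · have h3 := hR j ⟨n, z⟩ x
      have := hR0 j
      calc _ ≤ ((2 : ℝ) ^ n) ^ j * R j * δ ^ j :=
            mul_le_mul_of_nonneg_right h3 (by positivity)
        _ = ((2 : ℝ) ^ n * δ) ^ j * R j := by rw [mul_pow]; ring
        _ ≤ (32 * ((d : ℝ) + 1)) ^ j * R j := by gcongr

end

/-! ### Taylor polynomials at different base points -/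

section
open Filter Topology
variable {d m : ℕ} {X : Compacts (Euc d)}

theorem abs_taylorMonomial_le (ν : Fin d → ℕ) {a z : Euc d} {r : ℝ} (h : dist z a ≤ r) :
    |taylorMonomial ν a z| ≤ r ^ ∑ i, ν i := by
  have hr : 0 ≤ r := dist_nonneg.trans h
  rw [taylorMonomial, Finset.abs_prod, ← Finset.prod_pow_eq_pow_sum]
  refine Finset.prod_le_prod (fun _ _ => abs_nonneg _) fun i _ => ?_
  rw [abs_div, abs_pow, Nat.abs_cast]
  have h1 : |z i - a i| ≤ r := by
    have := PiLp.norm_apply_le (z - a) i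
    rw [PiLp.sub_apply, Real.norm_eq_abs, ← dist_eq_norm] at this
    exact this.trans h
  refine (div_le_self (by positivity) ?_).trans (pow_le_pow_left₀ (abs_nonneg _) h1 _)
  exact_mod_cast (ν i).factorial_pos

theorem norm_foldr_pd_taylorPoly_le (F : Jet m X) (b : X) {x : Euc d} {r ω : ℝ}
    (hx : dist x b ≤ r) (hω : 0 ≤ ω) (hF : ∀ k : MultiIndex d m, ‖F k b‖ ≤ ω * r ^ (m - ∑ i, k.1 i))
    (L : List (Fin d)) (hL : L.length ≤ m) :
    ‖L.foldr pd (taylorPoly F b) x‖ ≤ Fintype.card (MultiIndex d m) * (ω * r ^ (m - L.length)) := by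
  have hr : 0 ≤ r := dist_nonneg.trans hx
  rw [foldr_pd_taylorPoly F b L hL]
  refine (norm_sum_le_of_le _ fun k _ => ?_).trans_eq
    (by rw [Finset.sum_const, Finset.card_univ, nsmul_eq_mul])
  split_ifs with h
  · have h1 : L.length ≤ ∑ i, k.1 i := by
      rw [← sum_count]; exact Finset.sum_le_sum fun i _ => h i
    have h2 : ∑ i, (k.1 i - L.count i) = ∑ i, k.1 i - L.length := by
      rw [Finset.sum_tsub_distrib _ fun i _ => h i, sum_count]
    have h3 := abs_taylorMonomial_le (fun i => k.1 i - L.count i) hx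
    rw [h2] at h3
    rw [norm_mul, Complex.norm_real, Real.norm_eq_abs]
    calc _ ≤ r ^ (∑ i, k.1 i - L.length) * (ω * r ^ (m - ∑ i, k.1 i)) :=
          mul_le_mul h3 (hF k) (norm_nonneg _) (by positivity)
      _ = ω * r ^ ((∑ i, k.1 i - L.length) + (m - ∑ i, k.1 i)) := by rw [pow_add]; ring
      _ = _ := by
        congr 2
        have := k.2
        omega
  · rw [zero_mul, norm_zero]
    positivity

theorem partialDeriv_taylorPoly_self (F : Jet m X) (a : X) (k : MultiIndex d m) :
    partialDeriv k.1 (taylorPoly F a) a = F k a := by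
  rw [partialDeriv, foldr_pd_taylorPoly F a _ (by rw [length_indexList]; exact k.2),
    Finset.sum_eq_single k]
  · simp only [count_indexList, le_refl, implies_true, if_true, Nat.sub_self]
    simp [taylorMonomial]
  · intro l _ hl
    simp only [count_indexList]
    split_ifs with h
    · rw [taylorMonomial_self, if_neg]
      · simp
      · intro h0
        refine hl (Subtype.ext (funext fun i => le_antisymm ?_ (h i)))
        exact Nat.sub_eq_zero_iff_le.1 (congrFun h0 i)
    · simp
  · simp

theorem remainder_self (F : Jet m X) (a : X) (k : MultiIndex d m) : remainder F a k a = 0 :=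
  sub_eq_zero.2 (partialDeriv_taylorPoly_self F a k).symm

theorem foldr_pd_taylorPoly_const (F : Jet m X) (a : X) (L : List (Fin d)) (hL : L.length = m)
    (y z : Euc d) : L.foldr pd (taylorPoly F a) y = L.foldr pd (taylorPoly F a) z := by
  rw [foldr_pd_taylorPoly F a L hL.le, foldr_pd_taylorPoly F a L hL.le]
  refine Finset.sum_congr rfl fun k _ => ?_
  split_ifs with h
  · have h1 : ∀ i, k.1 i - L.count i = 0 := by
      have h2 : ∑ i, (k.1 i - L.count i) = 0 := by
        rw [Finset.sum_tsub_distrib _ fun i _ => h i, sum_count]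
        have := k.2
        omega
      simpa using h2
    simp [taylorMonomial, h1]
  · rfl

/-- A Taylor polynomial of degree at most `m` is its own Taylor polynomial of order `m` at every
point. -/
theorem taylorPoly_jetOf_taylorPoly (F : Jet m X) (a b : X) :
    taylorPoly (jetOf X (taylorPoly F a)) b = taylorPoly F a := by
  refine Subtype.ext (funext fun x => ?_)
  let X' : Compacts (Euc d) := ⟨{(b : Euc d), x}, (Set.toFinite _).isCompact⟩
  have h := norm_remainder_jetOf_le (taylorPoly F a) (X := X') ⟨b, Or.inl rfl⟩ ⟨x, Or.inr rfl⟩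
    ⟨0, by simp⟩ (M := 0) (fun z _ L hL => by
      rw [foldr_pd_taylorPoly_const F a L hL z b, sub_self, norm_zero])
  rw [mul_zero, zero_mul, norm_le_zero_iff] at h
  have h1 : partialDeriv 0 (taylorPoly F a) x -
      partialDeriv 0 (taylorPoly (jetOf X (taylorPoly F a)) b) x = 0 := h
  rw [partialDeriv_zero_index, partialDeriv_zero_index] at h1
  exact (sub_eq_zero.1 h1).symm

theorem taylorPoly_add (F G : Jet m X) (a : X) :
    taylorPoly (F + G) a = taylorPoly F a + taylorPoly G a :=
  Subtype.ext <| funext fun x => by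
    show _ = (∑ k : MultiIndex d m, (taylorMonomial k.1 a x : ℂ) * F k a) +
      ∑ k : MultiIndex d m, (taylorMonomial k.1 a x : ℂ) * G k a
    simp [taylorPoly, mul_add, Finset.sum_add_distrib]

theorem taylorPoly_smul (c : ℂ) (F : Jet m X) (a : X) :
    taylorPoly (c • F) a = c • taylorPoly F a :=
  Subtype.ext <| funext fun x => by
    show _ = c * ∑ k : MultiIndex d m, (taylorMonomial k.1 a x : ℂ) * F k a
    simp [taylorPoly, Finset.mul_sum, mul_left_comm]

/-- The change of the Taylor polynomial under a change of the base point is governed by the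
remainder. -/
theorem taylorPoly_sub_taylorPoly (F : Jet m X) (a b : X) :
    taylorPoly F b - taylorPoly F a = taylorPoly (remainder F a) b := by
  have h : F = remainder F a + jetOf X (taylorPoly F a) := by rw [remainder, sub_add_cancel]
  have h1 := taylorPoly_add (remainder F a) (jetOf X (taylorPoly F a)) b
  rw [← h, taylorPoly_jetOf_taylorPoly] at h1
  rw [h1, add_sub_cancel_right]

/-- The estimates `|(R^m_a F)^k(b)| ≤ ω |a - b|^{m - |k|}` for points of distance at most `r`. For a
Whitney jet they hold with `ω = ‖F‖` for all `r`, and with any `ω > 0` for small `r`. -/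
def RemainderBound (F : Jet m X) (ω r : ℝ) : Prop :=
  ∀ a b : X, dist a b ≤ r → ∀ k, ‖remainder F a k b‖ ≤ ω * dist a b ^ (m - ∑ i, k.1 i)

theorem RemainderBound.norm_foldr_pd_le {F : Jet m X} {ω r : ℝ} (h : RemainderBound F ω r)
    (hω : 0 ≤ ω) {a b : X} {x : Euc d} (hab : dist a b ≤ r) (hx : dist x b ≤ r)
    (L : List (Fin d)) (hL : L.length ≤ m) :
    ‖L.foldr pd (taylorPoly F b - taylorPoly F a : Cm d m) x‖ ≤
      Fintype.card (MultiIndex d m) * (ω * r ^ (m - L.length)) := by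
  rw [taylorPoly_sub_taylorPoly]
  exact norm_foldr_pd_taylorPoly_le _ b hx hω (fun k => (h a b hab k).trans (by gcongr)) L hL

theorem RemainderBound.norm_iteratedFDeriv_le {F : Jet m X} {ω r : ℝ} (h : RemainderBound F ω r)
    (hω : 0 ≤ ω) {a b : X} {x : Euc d} (hab : dist a b ≤ r) (hx : dist x b ≤ r)
    {n : ℕ} (hn : n ≤ m) :
    ‖iteratedFDeriv ℝ n (taylorPoly F b - taylorPoly F a : Cm d m) x‖ ≤
      (d : ℝ) ^ n * (Fintype.card (MultiIndex d m) * (ω * r ^ (m - n))) :=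
  Whitney.norm_iteratedFDeriv_le (taylorPoly F b - taylorPoly F a : Cm d m).contDiff hn
    fun L hL => hL ▸ h.norm_foldr_pd_le hω hab hx L (hL ▸ hn)

theorem RemainderBound.mono {F : Jet m X} {ω r r' : ℝ} (h : RemainderBound F ω r) (hr : r' ≤ r) :
    RemainderBound F ω r' := fun a b hab => h a b (hab.trans hr)

theorem IsWhitney.exists_remainderBound {F : Jet m X} (hF : IsWhitney F) {ω : ℝ} (hω : 0 < ω) :
    ∃ r > 0, RemainderBound F ω r := by
  have h : ∀ᶠ p : X × X in 𝓤 X, ∀ k : MultiIndex d m,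
      ‖remainder F p.1 k p.2‖ ≤ ω * ‖dist p.1 p.2 ^ (m - ∑ i, k.1 i)‖ :=
    eventually_all.2 fun k => (hF k).bound hω
  obtain ⟨r, hr, h⟩ := Metric.mem_uniformity_dist.1 h
  refine ⟨r / 2, half_pos hr, fun a b hab k => ?_⟩
  have := h (a := a) (b := b) (by linarith) k
  rwa [Real.norm_of_nonneg (by positivity)] at this

theorem WhitneyJet.remainderBound (F : WhitneyJet m X) (r : ℝ) : RemainderBound F.1 ‖F‖ r := by
  intro a b _ k
  have h0 : remNorm F ≤ ‖F‖ := le_add_of_nonneg_left (supNorm_nonneg F)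
  rcases eq_or_ne a b with rfl | hab
  · rw [remainder_self, norm_zero]
    positivity
  · have h1 := (le_ciSup (bddAbove_remNorm F) (⟨(a, b), hab⟩, k)).trans h0
    rwa [div_le_iff₀ (pow_pos (dist_pos.2 hab) _)] at h1

theorem WhitneyJet.norm_apply_le (F : WhitneyJet m X) (k : MultiIndex d m) (x : X) :
    ‖F.1 k x‖ ≤ ‖F‖ :=
  (le_ciSup (bddAbove_supNorm F) (x, k)).trans (le_add_of_nonneg_right (remNorm_nonneg F))

end

/-! ### The Whitney extension operator -/

/-- A smooth partition of unity on the complement of `X`, with a point `a i` of `X` for each member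
`θ i`, that is adapted to the distance from `X`: near each point `x` outside `X` at most `N` members
matter, their points `a i` are about as far from `x` as `X` is, and their derivatives of order `j`
are at most `C j` times the `-j`-th power of the distance from `x` to `X`. -/
structure Partition {d : ℕ} (X : Set (Euc d)) where
  /-- the index set -/
  ι : Type
  /-- the members of the partition of unity -/
  θ : ι → Euc d → ℝ
  /-- the points of `X` close to their supports -/
  a : ι → X
  /-- the bound for the number of members that matter near a point -/
  N : ℕ
  /-- the bounds for the derivatives -/
  C : ℕ → ℝ
  contDiff : ∀ i (n : ℕ), ContDiff ℝ n (θ i)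
  C_nonneg : ∀ j, 0 ≤ C j
  exists_finset : ∀ x ∉ X, ∃ B : Finset ι, B.card ≤ N ∧
    (∀ᶠ y in nhds x, (∀ i ∉ B, θ i y = 0) ∧ ∑ i ∈ B, θ i y = 1) ∧
    ∀ i ∈ B, dist x (a i) ≤ 65 * Metric.infDist x X ∧
      ∀ j, ‖iteratedFDeriv ℝ j (θ i) x‖ * Metric.infDist x X ^ j ≤ C j

theorem nonempty_partition {d : ℕ} {X : Set (Euc d)} (hX : IsClosed X) (hne : X.Nonempty) :
    Nonempty (Partition X) := by
  obtain ⟨ι, θ, a, N, C, h1, h2, h3⟩ := exists_whitney_partition hX hne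
  exact ⟨⟨ι, θ, a, N, C, h1, h2, h3⟩⟩

section
open Filter Topology
variable {d m : ℕ} {X : Compacts (Euc d)} (P : Partition (X : Set (Euc d)))

/-- The multi-index `0`. -/
def zeroIndex (d m : ℕ) : MultiIndex d m := ⟨0, by simp⟩

open Classical in
/-- Whitney's extension of the jet `F`: the function `F^0` on `X`, and a weighted mean of the Taylor
polynomials of `F` at nearby points of `X` outside `X`. -/
def extend (F : Jet m X) (x : Euc d) : ℂ :=
  if h : x ∈ X then F (zeroIndex d m) ⟨x, h⟩ else ∑ᶠ i, P.θ i x • taylorPoly F (P.a i) x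

theorem isOpen_compl (X : Compacts (Euc d)) : IsOpen (X : Set (Euc d))ᶜ :=
  X.isCompact.isClosed.isOpen_compl

theorem extend_eq_sum {F : Jet m X} {x : Euc d} (hx : x ∉ X) {B : Finset P.ι}
    (hB : ∀ i ∉ B, P.θ i x = 0) :
    extend P F x = ∑ i ∈ B, P.θ i x • taylorPoly F (P.a i) x := by
  rw [extend, dif_neg hx]
  refine finsum_eq_sum_of_support_subset _ fun i hi => ?_
  by_contra h
  exact hi (by simp [hB i (by simpa using h)])

theorem extend_add (F G : Jet m X) : extend P (F + G) = extend P F + extend P G := by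
  funext x
  rw [Pi.add_apply]
  by_cases hx : x ∈ X
  · simp [extend, hx]
  · obtain ⟨B, -, hB, -⟩ := P.exists_finset x hx
    have hB := hB.self_of_nhds.1
    rw [extend_eq_sum P hx hB, extend_eq_sum P hx hB, extend_eq_sum P hx hB,
      ← Finset.sum_add_distrib]
    refine Finset.sum_congr rfl fun i _ => ?_
    rw [taylorPoly_add, ← smul_add]
    rfl

theorem extend_smul (c : ℂ) (F : Jet m X) : extend P (c • F) = c • extend P F := by
  funext x
  rw [Pi.smul_apply]
  by_cases hx : x ∈ X
  · simp [extend, hx]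
  · obtain ⟨B, -, hB, -⟩ := P.exists_finset x hx
    have hB := hB.self_of_nhds.1
    rw [extend_eq_sum P hx hB, extend_eq_sum P hx hB, Finset.smul_sum]
    refine Finset.sum_congr rfl fun i _ => ?_
    rw [taylorPoly_smul, smul_comm]
    rfl

/-- Outside `X`, the extension is locally equal to a `C^m` function. -/
theorem extend_eventuallyEq (F : Jet m X) {x : Euc d} (hx : x ∉ X) :
    ∃ h : Cm d m, extend P F =ᶠ[𝓝 x] h := by
  obtain ⟨B, -, hB, -⟩ := P.exists_finset x hx
  refine ⟨⟨fun y => ∑ i ∈ B, P.θ i y • taylorPoly F (P.a i) y, show ContDiff ℝ m _ from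
    ContDiff.sum fun i _ => (P.contDiff i m).smul (taylorPoly F (P.a i)).contDiff⟩, ?_⟩
  filter_upwards [hB, (isOpen_compl X).mem_nhds hx] with y hy hyX
  exact extend_eq_sum P hyX hy.1

/-- Outside `X`, the extension `∑ θ_i T_{a_i} F` is close to the Taylor polynomial at a nearest point
`c` of `X`: the difference is `∑ θ_i (T_{a_i} F - T_c F)`, and in Leibniz' rule each derivative of
`θ_i` costs one power of the distance to `X`, which the difference of the Taylor polynomials
provides. -/
theorem exists_bound_extend_sub_nearest (m n : ℕ) (hn : n ≤ m) : ∃ K : ℝ, 0 ≤ K ∧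
    ∀ (F : Jet m X) (ω : ℝ) (x : Euc d) (c : X), 0 ≤ ω → x ∉ X →
      Metric.infDist x X = dist x c → RemainderBound F ω (66 * dist x c) →
      ∀ ν : Fin d → ℕ, ∑ i, ν i = n →
      ‖partialDeriv ν (extend P F) x - partialDeriv ν (taylorPoly F c) x‖ ≤
        K * (ω * dist x c ^ (m - n)) := by
  set M : ℝ := ((Fintype.card (MultiIndex d m) : ℕ) : ℝ) with hM
  refine ⟨P.N * ∑ l ∈ Finset.range (n + 1), (n.choose l : ℝ) * P.C l *
    ((d : ℝ) ^ (n - l) * (M * 66 ^ (m - (n - l)))),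
    mul_nonneg (Nat.cast_nonneg _) (Finset.sum_nonneg fun l _ => by
      have := P.C_nonneg l; positivity), ?_⟩
  intro F ω x c hω hx hc hR ν hν
  obtain ⟨B, hcard, hB, hbound⟩ := P.exists_finset x hx
  set δ := dist x c with hδ
  have hδ0 : 0 ≤ δ := dist_nonneg
  let u : P.ι → Cm d m := fun i => taylorPoly F (P.a i) - taylorPoly F c
  have hsm : ∀ i, ContDiff ℝ m fun y => P.θ i y • u i y := fun i =>
    (P.contDiff i m).smul (u i).contDiff
  have hh : ContDiff ℝ m fun y => ∑ i ∈ B, P.θ i y • u i y := ContDiff.sum fun i _ => hsm i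
  have heq : extend P F =ᶠ[𝓝 x]
      (fun y => ∑ i ∈ B, P.θ i y • u i y) + (taylorPoly F c : Euc d → ℂ) := by
    filter_upwards [hB, (isOpen_compl X).mem_nhds hx] with y hy hyX
    rw [extend_eq_sum P hyX hy.1, Pi.add_apply]
    have h1 : (taylorPoly F c : Euc d → ℂ) y = ∑ i ∈ B, P.θ i y • taylorPoly F c y := by
      rw [← Finset.sum_smul, hy.2, one_smul]
    rw [h1, ← Finset.sum_add_distrib]
    refine Finset.sum_congr rfl fun i _ => ?_
    have h2 : u i y = taylorPoly F (P.a i) y - taylorPoly F c y := rfl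
    rw [h2, ← smul_add, sub_add_cancel]
  have hpd : partialDeriv ν (extend P F) x =
      partialDeriv ν (fun y => ∑ i ∈ B, P.θ i y • u i y) x + partialDeriv ν (taylorPoly F c) x := by
    rw [partialDeriv, (foldr_pd_congr heq (indexList ν)).self_of_nhds]
    exact congrFun (partialDeriv_add hh (taylorPoly F c).contDiff ν (hν.trans_le hn)) x
  rw [hpd, add_sub_cancel_right]
  refine (norm_partialDeriv_le_iteratedFDeriv hh ν (hν.trans_le hn) x).trans ?_
  have hnm : (n : WithTop ℕ∞) ≤ m := by exact_mod_cast hn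
  rw [hν, iteratedFDeriv_fun_sum_apply fun i _ => ((hsm i).of_le hnm).contDiffAt]
  have hterm : ∀ i ∈ B, ‖iteratedFDeriv ℝ n (fun y => P.θ i y • u i y) x‖ ≤
      (∑ l ∈ Finset.range (n + 1), (n.choose l : ℝ) * P.C l *
        ((d : ℝ) ^ (n - l) * (M * 66 ^ (m - (n - l))))) * (ω * δ ^ (m - n)) := by
    intro i hi
    obtain ⟨hi1, hi2⟩ := hbound i hi
    rw [hc] at hi1
    refine (norm_iteratedFDeriv_smul_le (N := m) (P.contDiff i m) (u i).contDiff x hnm).trans ?_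
    rw [Finset.sum_mul]
    refine Finset.sum_le_sum fun l hl => ?_
    have hln : l ≤ n := Nat.lt_succ_iff.1 (Finset.mem_range.1 hl)
    -- `a i` is within `65 δ` of `x`, hence within `66 δ` of `c`
    have h1 := hR.norm_iteratedFDeriv_le hω (a := c) (b := P.a i) (x := x) (n := n - l)
      (by
        have := dist_triangle_left (c : Euc d) (P.a i) x
        have h' : dist c (P.a i) = dist (c : Euc d) (P.a i) := rfl
        linarith) (by linarith) (by omega)
    have h2 := hi2 l
    rw [hc] at h2
    have h3 : (66 * δ) ^ (m - (n - l)) = 66 ^ (m - (n - l)) * (δ ^ l * δ ^ (m - n)) := by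
      rw [mul_pow, ← pow_add]
      congr 2
      omega
    rw [h3] at h1
    calc _ ≤ (n.choose l : ℝ) * ‖iteratedFDeriv ℝ l (P.θ i) x‖ *
          ((d : ℝ) ^ (n - l) * (M * (ω * (66 ^ (m - (n - l)) * (δ ^ l * δ ^ (m - n)))))) := by
          gcongr
      _ = (n.choose l : ℝ) * (‖iteratedFDeriv ℝ l (P.θ i) x‖ * δ ^ l) *
          ((d : ℝ) ^ (n - l) * (M * 66 ^ (m - (n - l)))) * (ω * δ ^ (m - n)) := by ring
      _ ≤ _ := by gcongr
  refine (norm_sum_le_of_le _ hterm).trans ?_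
  rw [Finset.sum_const, nsmul_eq_mul, ← mul_assoc]
  have h0 : 0 ≤ ∑ l ∈ Finset.range (n + 1), (n.choose l : ℝ) * P.C l *
      ((d : ℝ) ^ (n - l) * (M * 66 ^ (m - (n - l)))) :=
    Finset.sum_nonneg fun l _ => by have := P.C_nonneg l; positivity
  gcongr

open Classical in
/-- The candidates for the derivatives of the extension of `F`: the members of `F` on `X`, and the
derivatives of the extension outside `X`. Only the case `|ν| ≤ m` matters. -/
def extendDeriv (F : Jet m X) (ν : Fin d → ℕ) (x : Euc d) : ℂ :=
  if h : x ∈ X ∧ ∑ i, ν i ≤ m then F ⟨ν, h.2⟩ ⟨x, h.1⟩ else partialDeriv ν (extend P F) x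

theorem extendDeriv_of_mem (F : Jet m X) (k : MultiIndex d m) (x : X) :
    extendDeriv P F k.1 x = F k x := dif_pos ⟨x.2, k.2⟩

theorem extendDeriv_of_notMem (F : Jet m X) (ν : Fin d → ℕ) {x : Euc d} (hx : x ∉ X) :
    extendDeriv P F ν x = partialDeriv ν (extend P F) x := dif_neg fun h => hx h.1

theorem extendDeriv_zero (F : Jet m X) : extendDeriv P F 0 = extend P F := by
  funext x
  by_cases hx : x ∈ X
  · have := extendDeriv_of_mem P F (zeroIndex d m) ⟨x, hx⟩
    rw [extend, dif_pos hx, ← this]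
    rfl
  · rw [extendDeriv_of_notMem P F 0 hx, partialDeriv_zero_index]

/-- The derivatives of the extension are close to those of the Taylor polynomial at any point `a` of
`X`. Outside `X` this compares the Taylor polynomials at `a` and at a nearest point of `X`. -/
theorem exists_bound_extendDeriv_sub (m : ℕ) : ∃ K : ℝ, 0 ≤ K ∧
    ∀ (F : Jet m X) (ω : ℝ) (x : Euc d) (a : X), 0 ≤ ω → RemainderBound F ω (66 * dist x a) →
      ∀ ν : Fin d → ℕ, ∑ i, ν i ≤ m →
      ‖extendDeriv P F ν x - partialDeriv ν (taylorPoly F a) x‖ ≤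
        K * (ω * dist x a ^ (m - ∑ i, ν i)) := by
  have hex : ∀ n : ℕ, ∃ K : ℝ, 0 ≤ K ∧ (n ≤ m →
    ∀ (F : Jet m X) (ω : ℝ) (x : Euc d) (c : X), 0 ≤ ω → x ∉ X →
      Metric.infDist x X = dist x c → RemainderBound F ω (66 * dist x c) →
      ∀ ν : Fin d → ℕ, ∑ i, ν i = n →
      ‖partialDeriv ν (extend P F) x - partialDeriv ν (taylorPoly F c) x‖ ≤
        K * (ω * dist x c ^ (m - n))) := fun n => by
    by_cases hn : n ≤ m
    · obtain ⟨K, hK, h⟩ := exists_bound_extend_sub_nearest P m n hn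
      exact ⟨K, hK, fun _ => h⟩
    · exact ⟨0, le_rfl, fun h => absurd h hn⟩
  choose K hK0 hK using hex
  set M : ℝ := ((Fintype.card (MultiIndex d m) : ℕ) : ℝ) with hM
  have hKs : 0 ≤ ∑ n ∈ Finset.range (m + 1), K n := Finset.sum_nonneg fun n _ => hK0 n
  refine ⟨1 + (∑ n ∈ Finset.range (m + 1), K n + M * 2 ^ m), by positivity, ?_⟩
  intro F ω x a hω hR ν hν
  set ρ := dist x a with hρ
  have hρ0 : 0 ≤ ρ := dist_nonneg
  rw [one_add_mul]
  by_cases hx : x ∈ X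
  · have h1 : dist a ⟨x, hx⟩ = ρ := dist_comm _ _
    have h2 := hR a ⟨x, hx⟩ (by rw [h1]; linarith) ⟨ν, hν⟩
    have h3 : remainder F a ⟨ν, hν⟩ ⟨x, hx⟩ =
        extendDeriv P F ν x - partialDeriv ν (taylorPoly F a) x :=
      congrArg (· - _) (extendDeriv_of_mem P F ⟨ν, hν⟩ ⟨x, hx⟩).symm
    rw [h3, h1] at h2
    exact h2.trans (le_add_of_nonneg_right (by positivity))
  · obtain ⟨c, hc, hxc⟩ := X.isCompact.isClosed.exists_infDist_eq_dist ⟨a, a.2⟩ x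
    have hcρ : dist x c ≤ ρ := hxc ▸ Metric.infDist_le_dist_of_mem a.2
    rw [extendDeriv_of_notMem P F ν hx]
    have h1 := hK _ hν F ω x ⟨c, hc⟩ hω hx hxc (hR.mono (by
      show 66 * dist x c ≤ _
      linarith)) ν rfl
    have hac : dist a ⟨c, hc⟩ ≤ 2 * ρ := by
      have := dist_triangle_left (a : Euc d) c x
      have h' : dist a ⟨c, hc⟩ = dist (a : Euc d) c := rfl
      linarith
    have h2 := (hR.mono (by linarith : 2 * ρ ≤ 66 * ρ)).norm_foldr_pd_le hω hac
      (x := x) (by show dist x c ≤ _; linarith) (indexList ν) (by rwa [length_indexList])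
    rw [length_indexList] at h2
    have h3 : partialDeriv ν (taylorPoly F ⟨c, hc⟩ - taylorPoly F a : Cm d m) x =
        partialDeriv ν (taylorPoly F ⟨c, hc⟩) x - partialDeriv ν (taylorPoly F a) x :=
      congrFun (Cm.partialDeriv_sub _ _ ν hν) x
    have h4 : (indexList ν).foldr pd (taylorPoly F ⟨c, hc⟩ - taylorPoly F a : Cm d m) x =
        partialDeriv ν (taylorPoly F ⟨c, hc⟩) x - partialDeriv ν (taylorPoly F a) x := h3
    rw [h4] at h2
    have h5 : K (∑ i, ν i) ≤ ∑ n ∈ Finset.range (m + 1), K n :=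
      Finset.single_le_sum (fun n _ => hK0 n) (Finset.mem_range.2 (Nat.lt_succ_iff.2 hν))
    have h6 : (2 * ρ) ^ (m - ∑ i, ν i) ≤ 2 ^ m * ρ ^ (m - ∑ i, ν i) := by
      rw [mul_pow]
      gcongr
      · norm_num
      · omega
    have h7 := hK0 (∑ i, ν i)
    calc ‖partialDeriv ν (extend P F) x - partialDeriv ν (taylorPoly F a) x‖
        ≤ ‖partialDeriv ν (extend P F) x - partialDeriv ν (taylorPoly F ⟨c, hc⟩) x‖ +
          ‖partialDeriv ν (taylorPoly F ⟨c, hc⟩) x - partialDeriv ν (taylorPoly F a) x‖ :=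
          norm_sub_le_norm_sub_add_norm_sub _ _ _
      _ ≤ K (∑ i, ν i) * (ω * dist x c ^ (m - ∑ i, ν i)) +
          M * (ω * (2 * ρ) ^ (m - ∑ i, ν i)) := add_le_add h1 h2
      _ ≤ (∑ n ∈ Finset.range (m + 1), K n) * (ω * ρ ^ (m - ∑ i, ν i)) +
          M * (ω * (2 ^ m * ρ ^ (m - ∑ i, ν i))) := by gcongr
      _ = (∑ n ∈ Finset.range (m + 1), K n + M * 2 ^ m) * (ω * ρ ^ (m - ∑ i, ν i)) := by ring
      _ ≤ _ := le_add_of_nonneg_left (by positivity)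

/-- The Whitney condition makes the constant in the remainder bound arbitrarily small near `a`. -/
theorem isLittleO_extendDeriv_sub {F : Jet m X} (hF : IsWhitney F) (a : X) {ν : Fin d → ℕ}
    (hν : ∑ i, ν i ≤ m) :
    (fun x => extendDeriv P F ν x - partialDeriv ν (taylorPoly F a) x) =o[𝓝 (a : Euc d)]
      fun x => dist x a ^ (m - ∑ i, ν i) := by
  obtain ⟨K, hK0, hK⟩ := exists_bound_extendDeriv_sub P m
  refine isLittleO_iff.2 fun ε hε => ?_
  obtain ⟨r, hr, hR⟩ := hF.exists_remainderBound (ω := ε / (K + 1)) (by positivity)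
  filter_upwards [Metric.ball_mem_nhds (a : Euc d) (div_pos hr (by norm_num : (0 : ℝ) < 66))]
    with x hx
  have h := hK F (ε / (K + 1)) x a (by positivity)
    (hR.mono (by rw [Metric.mem_ball, lt_div_iff₀ (by norm_num)] at hx; linarith)) ν hν
  refine h.trans ?_
  rw [Real.norm_of_nonneg (by positivity), ← mul_assoc]
  gcongr
  rw [mul_div_assoc', div_le_iff₀ (by positivity)]
  nlinarith

theorem hasFDerivAt_extendDeriv {F : Jet m X} (hF : IsWhitney F) (ν : Fin d → ℕ)
    (hν : ∑ i, ν i < m) (x : Euc d) :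
    HasFDerivAt (extendDeriv P F ν)
      (gradCLM fun i => extendDeriv P F (ν + Pi.single i 1) x) x := by
  have hν' : ∀ i, ∑ j, (ν + Pi.single i 1 : Fin d → ℕ) j ≤ m := fun i => by
    rw [sum_add_single]; omega
  by_cases hx : x ∈ X
  · have h1 := hasFDerivAt_partialDeriv (taylorPoly F ⟨x, hx⟩).contDiff ν hν x
    have h2 : ∀ μ : Fin d → ℕ, ∑ i, μ i ≤ m →
        partialDeriv μ (taylorPoly F ⟨x, hx⟩) x = extendDeriv P F μ x := fun μ hμ =>
      (partialDeriv_taylorPoly_self F ⟨x, hx⟩ ⟨μ, hμ⟩).trans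
        (extendDeriv_of_mem P F ⟨μ, hμ⟩ ⟨x, hx⟩).symm
    simp only [h2 _ (hν' _)] at h1
    have h3 : HasFDerivAt
        (fun y => extendDeriv P F ν y - partialDeriv ν (taylorPoly F ⟨x, hx⟩) y)
        (0 : Euc d →L[ℝ] ℂ) x := by
      rw [hasFDerivAt_iff_isLittleO]
      simp only [h2 ν hν.le, sub_self, sub_zero, zero_apply]
      refine (isLittleO_extendDeriv_sub P hF ⟨x, hx⟩ hν.le).trans_isBigO ?_
      refine IsBigO.of_bound 1 ?_
      filter_upwards [Metric.ball_mem_nhds x one_pos] with y hy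
      rw [norm_pow, Real.norm_of_nonneg dist_nonneg, one_mul, ← dist_eq_norm]
      exact (pow_le_pow_of_le_one dist_nonneg (le_of_lt hy) (by omega : 1 ≤ m - ∑ i, ν i)).trans_eq
        (pow_one _)
    have h4 := h3.add h1
    rw [zero_add] at h4
    exact h4.congr_of_eventuallyEq (Eventually.of_forall fun y => by simp)
  · obtain ⟨h, hh⟩ := extend_eventuallyEq P F hx
    have h1 : ∀ μ, extendDeriv P F μ =ᶠ[𝓝 x] partialDeriv μ h := fun μ => by
      filter_upwards [foldr_pd_congr hh (indexList μ), (isOpen_compl X).mem_nhds hx] with y hy hyX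
      rw [extendDeriv_of_notMem P F μ hyX]
      exact hy
    simp only [(h1 _).self_of_nhds]
    exact (hasFDerivAt_partialDeriv h.contDiff ν hν x).congr_of_eventuallyEq (h1 ν)

theorem continuous_extendDeriv {F : Jet m X} (hF : IsWhitney F) (ν : Fin d → ℕ)
    (hν : ∑ i, ν i ≤ m) : Continuous (extendDeriv P F ν) := by
  refine continuous_iff_continuousAt.2 fun x => ?_
  rcases hν.lt_or_eq with hν' | hν'
  · exact (hasFDerivAt_extendDeriv P hF ν hν' x).continuousAt
  by_cases hx : x ∈ X
  · have h1 := isLittleO_extendDeriv_sub P hF ⟨x, hx⟩ hν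
    simp only [hν', Nat.sub_self, pow_zero] at h1
    have h2 := ((isLittleO_one_iff ℝ).1 h1).add
      (continuous_partialDeriv (taylorPoly F ⟨x, hx⟩).contDiff ν hν).continuousAt
    simp only [sub_add_cancel, zero_add] at h2
    rw [partialDeriv_taylorPoly_self F ⟨x, hx⟩ ⟨ν, hν⟩,
      ← extendDeriv_of_mem P F ⟨ν, hν⟩ ⟨x, hx⟩] at h2
    exact h2
  · obtain ⟨h, hh⟩ := extend_eventuallyEq P F hx
    have h1 : extendDeriv P F ν =ᶠ[𝓝 x] partialDeriv ν h := by
      filter_upwards [foldr_pd_congr hh (indexList ν), (isOpen_compl X).mem_nhds hx] with y hy hyX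
      rw [extendDeriv_of_notMem P F ν hyX]
      exact hy
    exact (continuous_partialDeriv h.contDiff ν hν).continuousAt.congr h1.symm

theorem contDiff_extend {F : Jet m X} (hF : IsWhitney F) : ContDiff ℝ m (extend P F) := by
  rw [← extendDeriv_zero]
  exact contDiff_of_hasFDerivAt_family (continuous_extendDeriv P hF)
    (hasFDerivAt_extendDeriv P hF) m 0 (by simp)

theorem partialDeriv_extend {F : Jet m X} (hF : IsWhitney F) (ν : Fin d → ℕ)
    (hν : ∑ i, ν i ≤ m) : partialDeriv ν (extend P F) = extendDeriv P F ν := by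
  rw [← extendDeriv_zero]
  exact partialDeriv_of_hasFDerivAt_family (hasFDerivAt_extendDeriv P hF) ν hν

/-- Whitney's extension operator as a linear map. -/
def extendLinear (m : ℕ) : WhitneyJet m X →ₗ[ℂ] Cm d m where
  toFun F := ⟨extend P F.1, contDiff_extend P F.2⟩
  map_add' F G := Subtype.ext (extend_add P F.1 G.1)
  map_smul' c F := Subtype.ext (extend_smul P c F.1)

theorem ballSeminorm_extendLinear_le (a : X) (n : ℕ) :
    ∃ C, ∀ F : WhitneyJet m X, Cm.ballSeminorm d m n (extendLinear P m F) ≤ C * ‖F‖ := by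
  obtain ⟨K, hK0, hK⟩ := exists_bound_extendDeriv_sub P m
  set M : ℝ := ((Fintype.card (MultiIndex d m) : ℕ) : ℝ) with hM
  set r : ℝ := 1 + n + ‖(a : Euc d)‖ with hr
  have hr1 : 1 ≤ r := by
    have : (0 : ℝ) ≤ n := n.cast_nonneg
    linarith [norm_nonneg (a : Euc d)]
  refine ⟨(K + M) * r ^ m, fun F => Cm.ballSeminorm_le (by positivity) fun x hx ν hν => ?_⟩
  have hxa : dist x a ≤ r := by
    rw [dist_eq_norm]
    exact (norm_sub_le _ _).trans (by linarith)
  have h1 := hK F.1 ‖F‖ x a (norm_nonneg _) (F.remainderBound _) ν hν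
  have h2 := norm_foldr_pd_taylorPoly_le F.1 a hxa (norm_nonneg F)
    (fun k => (F.norm_apply_le k a).trans
      (le_mul_of_one_le_right (norm_nonneg _) (one_le_pow₀ hr1)))
    (indexList ν) (by rwa [length_indexList])
  rw [length_indexList] at h2
  have h3 : partialDeriv ν (extendLinear P m F) x = extendDeriv P F.1 ν x :=
    congrFun (partialDeriv_extend P F.2 ν hν) x
  have h4 : r ^ (m - ∑ i, ν i) ≤ r ^ m := pow_le_pow_right₀ hr1 (Nat.sub_le _ _)
  have h5 : dist x a ^ (m - ∑ i, ν i) ≤ r ^ m := (by gcongr : _ ≤ r ^ (m - ∑ i, ν i)).trans h4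
  rw [h3]
  calc ‖extendDeriv P F.1 ν x‖
      ≤ ‖extendDeriv P F.1 ν x - partialDeriv ν (taylorPoly F.1 a) x‖ +
        ‖partialDeriv ν (taylorPoly F.1 a) x‖ := norm_le_norm_sub_add _ _
    _ ≤ K * (‖F‖ * dist x a ^ (m - ∑ i, ν i)) + M * (‖F‖ * r ^ (m - ∑ i, ν i)) :=
      add_le_add h1 h2
    _ ≤ K * (‖F‖ * r ^ m) + M * (‖F‖ * r ^ m) := by gcongr
    _ = _ := by ring

end

/-- Whitney's extension theorem: the jet map has a continuous linear section. -/
theorem nonempty_jetSection {d : ℕ} (m : ℕ) (X : Compacts (Euc d)) : Nonempty (JetSection m X) := by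
  rcases (X : Set (Euc d)).eq_empty_or_nonempty with hX | ⟨a, ha⟩
  · refine ⟨⟨0, fun G => Subtype.ext (funext fun k => ContinuousMap.ext fun x => ?_)⟩⟩
    have : (x : Euc d) ∈ (X : Set (Euc d)) := x.2
    rw [hX] at this
    exact this.elim
  · obtain ⟨P⟩ := nonempty_partition X.isCompact.isClosed ⟨a, ha⟩
    refine ⟨⟨⟨extendLinear P m, Cm.continuous_of_bound _ (ballSeminorm_extendLinear_le P ⟨a, ha⟩)⟩,
      fun G => Subtype.ext (funext fun k => ContinuousMap.ext fun x => ?_)⟩⟩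
    exact (congrFun (partialDeriv_extend P G.2 k.1 k.2) x).trans (extendDeriv_of_mem P G.1 k x)

/-! ### Renormalization schemes, sections of the jet map and renormalization sections -/

section
open Filter Topology
variable {d m : ℕ} {X : Compacts (Euc d)}

/-- Evaluation at a point, as a continuous linear functional on `E^m(ℝ^d)`. -/
def evalCLM (m : ℕ) (x : Euc d) : Cm d m →L[ℂ] ℂ where
  toFun f := f x
  map_add' _ _ := rfl
  map_smul' _ _ := rfl
  cont := by
    let ev : Cm d m →ₗ[ℂ] ℂ :=
      { toFun := fun f => f x, map_add' := fun _ _ => rfl, map_smul' := fun _ _ => rfl }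
    obtain ⟨n, hn⟩ := exists_nat_ge ‖x‖
    refine continuous_of_continuousAt_zero ev ?_
    show Tendsto _ _ _
    rw [map_zero]
    refine squeeze_zero_norm (a := fun f => Cm.ballSeminorm d m n f) (fun f => ?_) ?_
    · have := Cm.norm_le_ballSeminorm f hn 0 (by simp)
      rwa [partialDeriv_zero_index] at this
    · simpa using (Cm.continuous_ballSeminorm (d := d) (m := m) n).tendsto 0

theorem mem_flatFunctions_iff (f : Cm d m) : f ∈ flatFunctions m X ↔ jetMap m X f = 0 := by
  constructor
  · intro h
    exact Subtype.ext (funext fun k => ContinuousMap.ext fun x => h x x.2 k.1 k.2)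
  · intro h x hx ν hν
    have h1 : jetOf X f = 0 := congrArg Subtype.val h
    exact congrArg (fun F : Jet m X => F ⟨ν, hν⟩ ⟨x, hx⟩) h1

/-- The continuous functionals separate the points of `I^m(X, ℝ^d)`. -/
theorem flatFunctions_ext {a b : flatFunctions m X}
    (h : ∀ τ : WeakDual ℂ (flatFunctions m X), τ a = τ b) : a = b :=
  Subtype.ext (Subtype.ext (funext fun x =>
    h (StrongDual.toWeakDual ((evalCLM m x).comp (flatFunctions m X).subtypeL))))

/-- The space of Whitney jets inherits completeness from `E^m(ℝ^d)`, through a continuous linear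
section of the jet map. -/
instance (m : ℕ) (X : Compacts (Euc d)) : CompleteSpace (WhitneyJet m X) := by
  obtain ⟨T⟩ := nonempty_jetSection m X
  refine NormedAddCommGroup.completeSpace_of_summable_imp_tendsto fun u hu => ?_
  obtain ⟨f, hf⟩ := Cm.exists_tendsto_of_summable (u := fun j => T.1 (u j)) fun n => by
    obtain ⟨C, -, hC⟩ := Cm.continuous_bound T.1 n
    exact Summable.of_nonneg_of_le (fun _ => apply_nonneg _ _) (fun j => hC (u j)) (hu.mul_left C)
  refine ⟨jetMap m X f, ?_⟩
  have := ((jetMap m X).continuous.tendsto f).comp hf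
  simpa only [Function.comp_def, map_sum, T.2] using this

/-- A linear section of the jet map with values in a closed subspace `D` that meets `I^m(X, ℝ^d)`
trivially is continuous: its graph is closed, as a limit point `(w, y)` has `y ∈ D` and
`J^m y = w`. -/
theorem continuous_of_section (S : WhitneyJet m X →ₗ[ℂ] Cm d m) {D : Submodule ℂ (Cm d m)}
    (hD : IsClosed (D : Set (Cm d m))) (hI : Disjoint (flatFunctions m X) D)
    (hS : ∀ w, jetMap m X (S w) = w) (hSD : ∀ w, S w ∈ D) : Continuous S := by
  refine Cm.continuous_of_bound S fun n => bound_of_seq_closed_graph (Cm.ballSeminorm d m)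
    Cm.ballSeminorm_mono (fun u hu => ?_) S (fun w w₀ y hw hy => ?_) n
  · obtain ⟨f, hf⟩ := Cm.exists_tendsto_of_summable hu
    exact ⟨f, (Cm.tendsto_iff _ _).1 hf⟩
  · have hy' : Tendsto (fun N => S (w N)) atTop (𝓝 y) := (Cm.tendsto_iff _ _).2 hy
    have h1 : y ∈ D := hD.mem_of_tendsto hy' (Eventually.of_forall fun N => hSD _)
    have h2 : jetMap m X y = w₀ := by
      have := ((jetMap m X).continuous.tendsto y).comp hy'
      simp only [Function.comp_def, hS] at this
      exact tendsto_nhds_unique this hw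
    have h3 : S w₀ - y ∈ flatFunctions m X := by
      rw [mem_flatFunctions_iff, map_sub, hS, h2, sub_self]
    exact sub_eq_zero.1 (Submodule.disjoint_def.1 hI _ h3 (D.sub_mem (hSD _) h1))

/-- The jet map restricted to a closed complement of `I^m(X, ℝ^d)` has a continuous inverse. It is
obtained from any section by projecting to `D` along `I^m(X, ℝ^d)`. -/
theorem RenormScheme.exists_section (D : RenormScheme m X) :
    ∃ T : JetSection m X, ∀ w, T.1 w ∈ D.1 := by
  obtain ⟨T₀⟩ := nonempty_jetSection m X
  let S : WhitneyJet m X →ₗ[ℂ] Cm d m :=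
    (D.1.projection (flatFunctions m X) D.2.2.symm).comp T₀.1.toLinearMap
  have hSD : ∀ w, S w ∈ D.1 := fun w => Submodule.projection_apply_mem _ _
  have hS : ∀ w, jetMap m X (S w) = w := fun w => by
    have h1 := LinearMap.congr_fun (Submodule.projection_add_projection_eq_id D.2.2) (T₀.1 w)
    have h2 := (mem_flatFunctions_iff _).1
      (Submodule.projection_apply_mem D.2.2 (T₀.1 w))
    have h3 := congrArg (jetMap m X) h1
    rw [LinearMap.add_apply, map_add, h2, zero_add] at h3
    exact h3.trans (T₀.2 w)
  exact ⟨⟨⟨S, continuous_of_section S D.2.1 D.2.2.disjoint hS hSD⟩, hS⟩, hSD⟩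

/-- The section of the jet map with range in the closed complement `D` of `I^m(X, ℝ^d)`. -/
def RenormScheme.toSection (D : RenormScheme m X) : JetSection m X := D.exists_section.choose

theorem RenormScheme.toSection_mem (D : RenormScheme m X) (w : WhitneyJet m X) :
    D.toSection.1 w ∈ D.1 := D.exists_section.choose_spec w

theorem RenormScheme.toSection_jetMap (D : RenormScheme m X) {φ : Cm d m} (hφ : φ ∈ D.1) :
    D.toSection.1 (jetMap m X φ) = φ := by
  have h : D.toSection.1 (jetMap m X φ) - φ ∈ flatFunctions m X := by
    rw [mem_flatFunctions_iff, map_sub, D.toSection.2, sub_self]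
  exact sub_eq_zero.1 (Submodule.disjoint_def.1 D.2.2.disjoint _ h
    (D.1.sub_mem (D.toSection_mem _) hφ))

theorem RenormScheme.range_toSection (D : RenormScheme m X) :
    LinearMap.range D.toSection.1.toLinearMap = D.1 := by
  ext φ
  constructor
  · rintro ⟨w, rfl⟩
    exact D.toSection_mem w
  · exact fun h => ⟨jetMap m X φ, D.toSection_jetMap h⟩

theorem JetSection.sub_mem (T : JetSection m X) (φ : Cm d m) :
    φ - T.1 (jetMap m X φ) ∈ flatFunctions m X := by
  rw [mem_flatFunctions_iff, map_sub, T.2, sub_self]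

/-- The continuous projection `φ ↦ φ - T (J^m φ)` onto `I^m(X, ℝ^d)`. -/
def JetSection.proj (T : JetSection m X) : Cm d m →L[ℂ] flatFunctions m X :=
  (ContinuousLinearMap.id ℂ (Cm d m) - T.1.comp (jetMap m X)).codRestrict (flatFunctions m X)
    T.sub_mem

theorem JetSection.coe_proj (T : JetSection m X) (φ : Cm d m) :
    (T.proj φ : Cm d m) = φ - T.1 (jetMap m X φ) := rfl

theorem JetSection.proj_coe (T : JetSection m X) (a : flatFunctions m X) : T.proj a = a :=
  Subtype.ext (by rw [T.coe_proj, (mem_flatFunctions_iff _).1 a.2, map_zero, sub_zero])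

/-- The transpose of the projection `φ ↦ φ - T (J^m φ)`. -/
def JetSection.toRenormSection (T : JetSection m X) : RenormSection m X :=
  ⟨transpose T.proj, fun τ => DFunLike.ext _ _ fun a => congrArg τ (T.proj_coe a)⟩

theorem JetSection.toRenormSection_apply (T : JetSection m X)
    (τ : WeakDual ℂ (flatFunctions m X)) (φ : Cm d m) :
    T.toRenormSection.1 τ φ = τ (T.proj φ) := rfl

theorem RenormSection.apply_coe (R : RenormSection m X) (τ : WeakDual ℂ (flatFunctions m X))
    (a : flatFunctions m X) : R.1 τ a = τ a :=
  congrArg (fun σ : WeakDual ℂ (flatFunctions m X) => σ a) (R.2 τ)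

/-- A weak star continuous functional on a dual is the evaluation at a vector; hence `R` is the
algebraic transpose of a map from `E^m(ℝ^d)` to `I^m(X, ℝ^d)`. -/
theorem RenormSection.exists_proj (R : RenormSection m X) (φ : Cm d m) :
    ∃ a : flatFunctions m X, ∀ τ, R.1 τ φ = τ a := by
  let f : StrongDual ℂ (WeakBilin (topDualPairing ℂ (flatFunctions m X))) :=
    { toFun := fun τ : WeakDual ℂ (flatFunctions m X) => R.1 τ φ
      map_add' := fun τ σ => by
        have : R.1 (τ + σ) = R.1 τ + R.1 σ := map_add R.1 τ σ
        exact congrArg (fun σ : WeakDual ℂ (Cm d m) => σ φ) this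
      map_smul' := fun c τ => by
        have : R.1 (c • τ) = c • R.1 τ := map_smul R.1 c τ
        exact congrArg (fun σ : WeakDual ℂ (Cm d m) => σ φ) this
      cont := (WeakDual.eval_continuous φ).comp R.1.continuous }
  obtain ⟨a, ha⟩ := LinearMap.dualEmbedding_surjective (topDualPairing ℂ (flatFunctions m X)) f
  exact ⟨a, fun τ => (DFunLike.congr_fun ha τ).symm⟩

/-- The annihilator of the range of `R`, a closed complement of `I^m(X, ℝ^d)`. -/
def RenormSection.toScheme (R : RenormSection m X) : RenormScheme m X :=
  ⟨{ carrier := {φ | ∀ τ, R.1 τ φ = 0}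
     add_mem' := fun {φ ψ} hφ hψ τ => by rw [map_add, hφ, hψ, add_zero]
     zero_mem' := fun τ => map_zero _
     smul_mem' := fun c φ hφ τ => by rw [map_smul, hφ, smul_zero] },
    by
      have h : {φ : Cm d m | ∀ τ, R.1 τ φ = 0} = ⋂ τ, {φ | R.1 τ φ = 0} := Set.ofPred_forall _
      change IsClosed {φ : Cm d m | ∀ τ, R.1 τ φ = 0}
      rw [h]
      refine isClosed_iInter fun τ => ?_
      exact isClosed_eq (WeakDual.toStrongDual (R.1 τ)).continuous continuous_const,
    by
      refine ⟨Submodule.disjoint_def.2 fun φ hφ hR => ?_, codisjoint_iff.2 ?_⟩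
      · have : (⟨φ, hφ⟩ : flatFunctions m X) = 0 := flatFunctions_ext fun τ => by
          rw [map_zero, ← R.apply_coe τ ⟨φ, hφ⟩]
          exact hR τ
        exact congrArg Subtype.val this
      · refine Submodule.eq_top_iff'.2 fun φ => ?_
        obtain ⟨a, ha⟩ := R.exists_proj φ
        refine Submodule.mem_sup.2 ⟨a, a.2, φ - a, fun τ => ?_, add_sub_cancel _ _⟩
        rw [map_sub, ha, R.apply_coe, sub_self]⟩

theorem RenormSection.mem_toScheme (R : RenormSection m X) (φ : Cm d m) :
    φ ∈ R.toScheme.1 ↔ ∀ τ, R.1 τ φ = 0 := Iff.rfl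

theorem JetSection.mem_toScheme (T : JetSection m X) (φ : Cm d m) :
    φ ∈ T.toRenormSection.toScheme.1 ↔ T.1 (jetMap m X φ) = φ := by
  rw [RenormSection.mem_toScheme]
  constructor
  · intro h
    have h1 : T.proj φ = 0 := flatFunctions_ext fun τ => by
      rw [map_zero, ← T.toRenormSection_apply, h]
    have h2 := congrArg Subtype.val h1
    exact (sub_eq_zero.1 h2).symm
  · intro h τ
    have h1 : T.proj φ = 0 := Subtype.ext (by rw [T.coe_proj, h, sub_self]; rfl)
    rw [T.toRenormSection_apply, h1, map_zero]

theorem RenormScheme.toScheme_toSection (D : RenormScheme m X) :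
    D.toSection.toRenormSection.toScheme = D := by
  refine Subtype.ext (Submodule.ext fun φ => ?_)
  rw [JetSection.mem_toScheme]
  exact ⟨fun h => h ▸ D.toSection_mem _, D.toSection_jetMap⟩

theorem RenormSection.toRenormSection_toScheme (R : RenormSection m X) :
    R.toScheme.toSection.toRenormSection = R := by
  refine Subtype.ext (ContinuousLinearMap.ext fun τ => DFunLike.ext _ _ fun φ => ?_)
  have h1 := R.apply_coe τ (R.toScheme.toSection.proj φ)
  rw [JetSection.coe_proj, map_sub, (R.mem_toScheme _).1 (R.toScheme.toSection_mem _) τ,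
    sub_zero] at h1
  exact h1.symm

theorem JetSection.toSection_toScheme (T : JetSection m X) :
    T.toRenormSection.toScheme.toSection = T := by
  refine Subtype.ext (ContinuousLinearMap.ext fun w => ?_)
  have h : T.1 w ∈ T.toRenormSection.toScheme.1 := by rw [T.mem_toScheme, T.2]
  have := T.toRenormSection.toScheme.toSection_jetMap h
  rwa [T.2] at this

theorem isShortExact_jetMap (m : ℕ) (X : Compacts (Euc d)) :
    IsShortExact (flatIncl m X) (jetMap m X) := by
  obtain ⟨T⟩ := nonempty_jetSection m X
  refine ⟨Subtype.val_injective, fun φ => ?_, fun w => ⟨T.1 w, T.2 w⟩⟩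
  rw [← mem_flatFunctions_iff]
  exact ⟨fun h => ⟨⟨φ, h⟩, rfl⟩, by rintro ⟨a, rfl⟩; exact a.2⟩

/-- The dual sequence is exact, as the jet map has a continuous linear section. -/
theorem isShortExact_transpose (m : ℕ) (X : Compacts (Euc d)) :
    IsShortExact (transpose (jetMap m X)) (transpose (flatIncl m X)) := by
  obtain ⟨T⟩ := nonempty_jetSection m X
  refine ⟨fun σ σ' h => DFunLike.ext _ _ fun w => ?_, fun μ => ⟨fun h => ?_, ?_⟩,
    fun τ => ⟨T.toRenormSection.1 τ, T.toRenormSection.2 τ⟩⟩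
  · have h1 : σ (jetMap m X (T.1 w)) = σ' (jetMap m X (T.1 w)) :=
      congrArg (fun μ : WeakDual ℂ (Cm d m) => μ (T.1 w)) h
    rwa [T.2] at h1
  · refine ⟨transpose T.1 μ, DFunLike.ext _ _ fun φ => ?_⟩
    have h1 : μ (φ - T.1 (jetMap m X φ)) = 0 :=
      congrArg (fun τ : WeakDual ℂ (flatFunctions m X) => τ (T.proj φ)) h
    rw [map_sub, sub_eq_zero] at h1
    exact h1.symm
  · rintro ⟨σ, rfl⟩
    refine DFunLike.ext _ _ fun a => ?_
    have h1 : σ (jetMap m X (a : Cm d m)) = 0 := by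
      rw [(mem_flatFunctions_iff _).1 a.2, map_zero]
    exact h1

/-- Renormalization sections correspond to closed complements, by annihilators and by transposes of
projections. -/
def schemeEquiv (m : ℕ) (X : Compacts (Euc d)) : RenormSection m X ≃ RenormScheme m X where
  toFun R := R.toScheme
  invFun D := D.toSection.toRenormSection
  left_inv R := R.toRenormSection_toScheme
  right_inv D := D.toScheme_toSection

/-- Renormalization sections correspond to sections of the jet map. -/
def sectionEquiv (m : ℕ) (X : Compacts (Euc d)) : RenormSection m X ≃ JetSection m X where
  toFun R := R.toScheme.toSection
  invFun T := T.toRenormSection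
  left_inv R := R.toRenormSection_toScheme
  right_inv T := T.toSection_toScheme

end

end Whitney

end

theorem theorem5p9 (d m : ℕ) (X : TopologicalSpace.Compacts (EuclideanSpace ℝ (Fin d))) :
    -- exactness of `0 → I^m(X, ℝ^d) → E^m(ℝ^d) → E^m(X) → 0` and of its dual sequence
    IsShortExact (flatIncl m X) (jetMap m X) ∧
    IsShortExact (transpose (jetMap m X)) (transpose (flatIncl m X)) ∧
    -- the three sets are not empty
    Nonempty (RenormScheme m X) ∧ Nonempty (JetSection m X) ∧ Nonempty (RenormSection m X) ∧
    -- the bijections, described in both directions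
    ∃ (𝓕 : RenormSection m X ≃ RenormScheme m X) (𝓙 : RenormSection m X ≃ JetSection m X),
      -- `𝓕 R = {φ | μ φ = 0 for all μ in the range of R}`
      (∀ (R : RenormSection m X) (φ : Cm d m), φ ∈ (𝓕 R).1 ↔ ∀ τ, R.1 τ φ = 0) ∧
      -- `𝓕⁻¹ D` is the transpose of the projection `I^m(X, ℝ^d) ⊕ D → I^m(X, ℝ^d)`
      (∀ (D : RenormScheme m X) (τ : WeakDual ℂ (flatFunctions m X)) (a : flatFunctions m X),
        ∀ b ∈ D.1, (𝓕.symm D).1 τ ((a : Cm d m) + b) = τ a) ∧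
      -- `𝓙 R` is the inverse of the restriction of `J^m` to `𝓕 R`
      (∀ R : RenormSection m X, LinearMap.range (𝓙 R).1.toLinearMap = (𝓕 R).1) ∧
      (∀ (R : RenormSection m X), ∀ φ ∈ (𝓕 R).1, (𝓙 R).1 (jetMap m X φ) = φ) ∧
      -- `𝓙⁻¹ T` is the transpose of `φ ↦ φ - T (J^m φ)`
      (∀ (T : JetSection m X) (τ : WeakDual ℂ (flatFunctions m X)) (φ : Cm d m)
        (a : flatFunctions m X), (a : Cm d m) = φ - T.1 (jetMap m X φ) →
        (𝓙.symm T).1 τ φ = τ a) := by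

  obtain ⟨T⟩ := nonempty_jetSection m X
  refine ⟨isShortExact_jetMap m X, isShortExact_transpose m X, ⟨T.toRenormSection.toScheme⟩, ⟨T⟩,
    ⟨T.toRenormSection⟩, schemeEquiv m X, sectionEquiv m X, fun R φ => R.mem_toScheme φ,
    fun D τ a b hb => ?_, fun R => R.toScheme.range_toSection,
    fun R φ hφ => R.toScheme.toSection_jetMap hφ, fun T τ φ a ha => ?_⟩
  · have h : D.toSection.proj ((a : Cm d m) + b) = a := Subtype.ext (by
      rw [JetSection.coe_proj, map_add, (mem_flatFunctions_iff _).1 a.2, zero_add,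
        D.toSection_jetMap hb, add_sub_cancel_right])
    exact congrArg τ h
  · exact congrArg τ (Subtype.ext ha.symm : T.proj φ = a)
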